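/- **Theorem 5.4.** Let $U=V=\mathbb C^3$ and let $\mathbf{Noc}=\mathrm{Hom}(S^2U,V)$ be the space of nets of conics, i.e. of quadratic maps $\varphi:U\to V$, equivalently of triples $M=(M_1,M_2,M_3)$ of quadratic forms on $U$. Let $\mathrm{GL}(U)\times\mathrm{GL}(V)$ act on it by $(g,h)\cdot\varphi=h\circ\varphi\circ g^{-1}$. For an algebraic character $\chi$ of $\mathrm{GL}(U)\times\mathrm{GL}(V)$ let $R_\chi(\mathbf{Noc})$ be the space of polynomial functions $f$ on $\mathbf{Noc}$ with $f((g,h)\cdot\varphi)=\chi(g,h)f(\varphi)$ for all $(g,h)$ and $\varphi$, and put $R(\mathbf{Noc})=\bigoplus_\chi R_\chi(\mathbf{Noc})$ (the semi-invariants). *Definition of $J_6$.* Let $e_1=\xi^2,\ e_2=\xi\eta,\ e_3=\xi\nu,\ e_4=\eta^2,\ e_5=\eta\nu,\ e_6=\nu^2$ be the monomial basis of $S^2U^*$, where $\xi,\eta,\nu$ are the coordinates on $U$; let $t_1,\dots,t_6$ be the dual basis and $t_{ijk}=t_i\wedge t_j\wedge t_k$, a linear function on $\wedge^3S^2U^*$.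 Let $I_2$ be the quadratic form on the Plücker space $\wedge^3S^2U^*\otimes\wedge^3V$ ($\wedge^3V\cong\mathbb C$ via the standard basis) given by $$\begin{aligned}-8I_2={}&t_{235}^2-8t_{146}^2-8t_{134}t_{346}+8t_{126}t_{246}+8t_{145}t_{156}+6t_{123}t_{456}-6t_{136}t_{245}+6t_{124}t_{356}\\&-4t_{125}t_{256}+4t_{135}t_{345}-4t_{234}t_{236}+2t_{134}t_{256}-2t_{125}t_{346}+2t_{135}t_{246}-2t_{126}t_{345}\\&+2t_{145}t_{236}+2t_{156}t_{234}-2t_{146}t_{235},\end{aligned}\tag{5}$$ and let $J_6(M)=I_2(M_1\wedge M_2\wedge M_3)$. *Definition of $J_{12}$.* Let $\delta(M)=\det(v_1A_1+v_2A_2+v_3A_3)\in S^3V$, where $A_k$ is the symmetric matrix of $M_k$ and $v_1,v_2,v_3$ is the standard basis of $V$. Let $a$ be Aronhold's invariant of degree 4 of ternary cubics, normalized to take the value $\alpha$ on $y^2z+x^3+\alpha xz^2+\beta z^3$; explicitly, on $$a_0x^3+b_0y^3+c_0z^3+3a_2x^2y+3a_3x^2z+3b_1xy^2+3b_3y^2z+3c_1xz^2+3c_2yz^2+6mxyz$$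 its value is 27 times $$\begin{aligned}&a_0b_0c_0m-(b_0c_0a_2a_3+c_0a_0b_1b_3+a_0b_0c_1c_2)-m(a_0b_3c_2+b_0c_1a_3+c_0a_2b_1)\\&+(a_0b_1c_2^2+a_0c_1b_3^2+b_0a_2c_1^2+b_0c_2a_3^2+c_0b_3a_2^2+c_0a_3b_1^2)-m^4+2m^2(b_1c_1+c_2a_2+a_3b_3)\\&-3m(a_2b_3c_1+a_3b_1c_2)-(b_1^2c_1^2+c_2^2a_2^2+a_3^2b_3^2)+(c_2a_2a_3b_3+a_3b_3b_1c_1+b_1c_1c_2a_2).\end{aligned}$$ Let $J_{12}(M)=-48\,a(\delta(M))$. Then: 1. The ring $\mathbb C[\mathbf{Noc}]^{\mathrm{SL}(U)\times\mathrm{SL}(V)}$ of invariant polynomial functions is freely generated by $J_6$ and $J_{12}$: these are algebraically independent over $\mathbb C$ and generate it as a $\mathbb C$-algebra. 2. This ring equals the ring $R(\mathbf{Noc})$ of semi-invariants of $\mathrm{GL}(U)\times\mathrm{GL}(V)$; $J_6$ and $J_{12}$ are relative invariants for the characters $\det(g)^{-4}\det(h)^2$ and $\det(g)^{-8}\det(h)^4$,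 respectively. 3. $I_2$ is an $\mathrm{SL}(U)\times\mathrm{SL}(V)$-invariant polynomial function, homogeneous of degree 2, on the Plücker space. The function $a$ is an $\mathrm{SL}(V)$-invariant polynomial function, homogeneous of degree 4, on $S^3V$, with $a(y^2z+x^3+\alpha xz^2+\beta z^3)=\alpha$ for all $\alpha,\beta\in\mathbb C$. 4. On the normal slice $N_C=\{\nu_{c,g}:c,g\in\mathbb C\}$, $\nu_{c,g}=(y^2+2xz,\ 2yz,\ -x^2+2g(xz-y^2)+cz^2)$, where $x,y,z$ denote the coordinates on $U$, one has $J_6(\nu_{c,g})=24g$ and $J_{12}(\nu_{c,g})=-48(c-3g^2)$. -/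

import Mathlib

open scoped MatrixGroups

noncomputable section

namespace NetsOfConics

/-! ### Polynomial functions, invariants and semi-invariants -/

section General

variable {G W : Type*} [Group G] [AddCommGroup W] [Module ℂ W]

/-- The coordinate ring `ℂ[W]` of a complex vector space `W`: the algebra of functions on `W`
generated by the linear functionals. -/
def coordinateRing (W : Type*) [AddCommGroup W] [Module ℂ W] : Subalgebra ℂ (W → ℂ) :=
  Algebra.adjoin ℂ (Set.range fun (l : Module.Dual ℂ W) (w : W) => l w)

/-- The ring `ℂ[W]^G` of polynomial invariants of a representation. -/
def invariantRing (ρ : Representation ℂ G W) : Subalgebra ℂ (W → ℂ) where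
  carrier := {f | f ∈ coordinateRing W ∧ ∀ g w, f (ρ g w) = f w}
  mul_mem' := by
    rintro a b ⟨ha, ha'⟩ ⟨hb, hb'⟩
    exact ⟨mul_mem ha hb, fun g w => by simp [ha', hb']⟩
  add_mem' := by
    rintro a b ⟨ha, ha'⟩ ⟨hb, hb'⟩
    exact ⟨add_mem ha hb, fun g w => by simp [ha', hb']⟩
  algebraMap_mem' r := ⟨Subalgebra.algebraMap_mem _ r, fun _ _ => rfl⟩

/-- The space `R_χ(W)` of relative invariants corresponding to the character `χ`. -/
def relativeInvariants (ρ : Representation ℂ G W) (χ : G →* ℂˣ) : Submodule ℂ (W → ℂ) where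
  carrier := {f | f ∈ coordinateRing W ∧ ∀ g w, f (ρ g w) = (χ g : ℂ) * f w}
  zero_mem' := ⟨zero_mem _, fun _ _ => by simp⟩
  add_mem' := by
    rintro a b ⟨ha, ha'⟩ ⟨hb, hb'⟩
    exact ⟨add_mem ha hb, fun g w => by simp [ha', hb', mul_add]⟩
  smul_mem' := by
    rintro c a ⟨ha, ha'⟩
    exact ⟨Subalgebra.smul_mem _ ha c, fun g w => by simp [ha', mul_left_comm]⟩

end General

/-! ### The groups and their characters -/

/-- `GL(U) × GL(V)` with `U = V = ℂ³`. -/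
abbrev GLGL : Type := GL (Fin 3) ℂ × GL (Fin 3) ℂ

/-- `SL(U) × SL(V)` with `U = V = ℂ³`. -/
abbrev SLSL : Type := SL(3, ℂ) × SL(3, ℂ)

/-- The inclusion of `SL(U) × SL(V)` in `GL(U) × GL(V)`. -/
def slToGL : SLSL →* GLGL :=
  MonoidHom.prodMap Matrix.SpecialLinearGroup.toGL Matrix.SpecialLinearGroup.toGL

/-- A homomorphism `GL(U) × GL(V) → ℂˣ` is an (algebraic) character if it is a regular function,
that is, a polynomial in the matrix entries divided by a power of the determinants. -/
def IsRegularCharacter (χ : GLGL →* ℂˣ) : Prop :=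
  ∃ (P : MvPolynomial ((Fin 3 × Fin 3) ⊕ (Fin 3 × Fin 3)) ℂ) (n : ℕ), ∀ g h : GL (Fin 3) ℂ,
    (χ (g, h) : ℂ) * (g.val.det * h.val.det) ^ n =
      MvPolynomial.eval (Sum.elim (fun p => g.val p.1 p.2) (fun p => h.val p.1 p.2)) P

/-- The character `χ_{a,b}(g, h) = det(g)^a det(h)^b`. -/
def detCharacter (a b : ℤ) : GLGL →* ℂˣ :=
  (Matrix.GeneralLinearGroup.det.comp (MonoidHom.fst _ _)) ^ a *
    (Matrix.GeneralLinearGroup.det.comp (MonoidHom.snd _ _)) ^ b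

/-- The space of semi-invariants `R(W) = ⊕_χ R_χ(W)` of a representation of `GL(U) × GL(V)`,
as the sum in `ℂ[W]` over all characters. -/
def semiInvariants {W : Type*} [AddCommGroup W] [Module ℂ W] (ρ : Representation ℂ GLGL W) :
    Submodule ℂ (W → ℂ) :=
  ⨆ χ : {χ : GLGL →* ℂˣ // IsRegularCharacter χ}, relativeInvariants ρ χ.1

/-! ### Nets of conics -/

/-- Quadratic forms on `U = ℂ³`, that is `S²U*`. -/
abbrev Conic : Type := QuadraticForm ℂ (Fin 3 → ℂ)

/-- Nets of conics: `Hom(S²U, V)` is the space of quadratic maps from `U = ℂ³` to `V = ℂ³`. -/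
abbrev Noc : Type := QuadraticMap ℂ (Fin 3 → ℂ) (Fin 3 → ℂ)

/-- The action of `GL(U)` on `S²U*`: `g • q = q ∘ g⁻¹`. -/
def conicRep : Representation ℂ (GL (Fin 3) ℂ) Conic where
  toFun g :=
    { toFun := fun q => q.comp (Matrix.toLin' (g⁻¹).val)
      map_add' := fun _ _ => rfl
      map_smul' := fun _ _ => rfl }
  map_one' := by
    ext q x
    simp
  map_mul' g h := by
    ext q x
    simp [mul_inv_rev, Matrix.mulVec_mulVec]

/-- The action of `GL(U) × GL(V)` on nets: `(g, h) • φ = h ∘ φ ∘ g⁻¹`. -/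
def nocRep : Representation ℂ GLGL Noc where
  toFun p :=
    { toFun := fun φ =>
        (Matrix.toLin' p.2.val).compQuadraticMap (φ.comp (Matrix.toLin' (p.1⁻¹).val))
      map_add' := fun φ φ' => by
        ext x : 1
        simp [Matrix.mulVec_add]
      map_smul' := fun c φ => by
        ext x : 1
        simp }
  map_one' := by
    ext φ x
    simp
  map_mul' p q := by
    ext φ x
    simp [mul_inv_rev, Matrix.mulVec_mulVec]

/-- The `k`-th conic `M_k ∈ S²U*` of a net, with respect to the standard basis of `V`. -/
def Noc.conic (φ : Noc) (k : Fin 3) : Conic :=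
  (LinearMap.proj k : (Fin 3 → ℂ) →ₗ[ℂ] ℂ).compQuadraticMap φ

/-- The net whose conics are `M 0, M 1, M 2`. -/
def Noc.ofConics (M : Fin 3 → Conic) : Noc :=
  ∑ k, (LinearMap.single ℂ (fun _ : Fin 3 => ℂ) k).compQuadraticMap (M k)

/-- The quadratic monomial `x_i x_j`. -/
def monom (i j : Fin 3) : Conic :=
  QuadraticMap.linMulLin (LinearMap.proj i) (LinearMap.proj j)

/-- The points `ν_{c,g} = (y² + 2xz, 2yz, -x² + 2g(xz - y²) + cz²)` of the normal slice. -/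
def nu (c g : ℂ) : Noc :=
  Noc.ofConics ![monom 1 1 + (2 : ℂ) • monom 0 2,
    (2 : ℂ) • monom 1 2,
    -monom 0 0 + (2 * g) • (monom 0 2 - monom 1 1) + c • monom 2 2]

/-! ### The Plücker map and the invariant of degree 6 -/

/-- The Plücker space `⋀³S²U* ⊗ ⋀³V`, with `⋀³V` identified with `ℂ` through the standard
basis of `V`. -/
abbrev PluckerSpace : Type := ⋀[ℂ]^3 Conic

/-- The action of `GL(U) × GL(V)` on the Plücker space. -/
def pluckerRep : Representation ℂ GLGL PluckerSpace where
  toFun p := p.2.val.det • exteriorPower.map 3 (conicRep p.1)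
  map_one' := by
    simp [Module.End.one_eq_id]
  map_mul' p q := by
    simp [Module.End.mul_eq_comp, ← exteriorPower.map_comp, smul_smul, mul_comm]

/-- The Plücker map `M ↦ M₁ ∧ M₂ ∧ M₃`. -/
def plucker (φ : Noc) : PluckerSpace :=
  exteriorPower.ιMulti ℂ 3 φ.conic

/-- The coefficient of `x_i x_j` (for `i ≠ j`) of a quadratic form, as a linear functional. -/
def coeffMixed (i j : Fin 3) : Module.Dual ℂ Conic where
  toFun q := QuadraticMap.polar q (Pi.single i 1) (Pi.single j 1)
  map_add' q q' := by simp [QuadraticMap.polar_add]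
  map_smul' c q := by simp [QuadraticMap.polar_smul]

/-- The coefficient of `x_i²` of a quadratic form, as a linear functional. -/
def coeffSq (i : Fin 3) : Module.Dual ℂ Conic where
  toFun q := q (Pi.single i 1)
  map_add' _ _ := rfl
  map_smul' _ _ := rfl

/-- The basis `t₁, …, t₆` of `(S²U*)*` dual to the basis
`e₁ = ξ², e₂ = ξη, e₃ = ξν, e₄ = η², e₅ = ην, e₆ = ν²` of `S²U*`. Here `tcoord n` is `t_n` for
`1 ≤ n ≤ 6`; other indices are not used. -/
def tcoord : ℕ → Module.Dual ℂ Conic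
  | 1 => coeffSq 0
  | 2 => coeffMixed 0 1
  | 3 => coeffMixed 0 2
  | 4 => coeffSq 1
  | 5 => coeffMixed 1 2
  | 6 => coeffSq 2
  | _ => 0

/-- The Plücker coordinate `t_{ijk} = t_i ∧ t_j ∧ t_k`. -/
def tc (i j k : ℕ) : Module.Dual ℂ PluckerSpace :=
  exteriorPower.pairingDual ℂ Conic 3
    (exteriorPower.ιMulti ℂ 3 ![tcoord i, tcoord j, tcoord k])

/-- The quadratic form `I₂` on the Plücker space. -/
def I₂ (w : PluckerSpace) : ℂ :=
  -(1 / 8) * (tc 2 3 5 w ^ 2 - 8 * tc 1 4 6 w ^ 2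
    - 8 * tc 1 3 4 w * tc 3 4 6 w + 8 * tc 1 2 6 w * tc 2 4 6 w + 8 * tc 1 4 5 w * tc 1 5 6 w
    + 6 * tc 1 2 3 w * tc 4 5 6 w - 6 * tc 1 3 6 w * tc 2 4 5 w + 6 * tc 1 2 4 w * tc 3 5 6 w
    - 4 * tc 1 2 5 w * tc 2 5 6 w + 4 * tc 1 3 5 w * tc 3 4 5 w - 4 * tc 2 3 4 w * tc 2 3 6 w
    + 2 * tc 1 3 4 w * tc 2 5 6 w - 2 * tc 1 2 5 w * tc 3 4 6 w
    + 2 * tc 1 3 5 w * tc 2 4 6 w - 2 * tc 1 2 6 w * tc 3 4 5 w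
    + 2 * tc 1 4 5 w * tc 2 3 6 w + 2 * tc 1 5 6 w * tc 2 3 4 w - 2 * tc 1 4 6 w * tc 2 3 5 w)

/-- `J₆ = I₂ ∘ ψ`, where `ψ` is the Plücker map. -/
def J₆ (φ : Noc) : ℂ := I₂ (plucker φ)

/-! ### The determinant map and the invariant of degree 12 -/

/-- Ternary cubic forms `S³V`: homogeneous polynomials of degree 3 in the basis of `V = ℂ³`. -/
abbrev Cubic : Type := MvPolynomial.homogeneousSubmodule (Fin 3) ℂ 3

/-- The linear form `∑ⱼ hⱼₖ vⱼ = h vₖ`. -/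
def linForm (h : Matrix (Fin 3) (Fin 3) ℂ) (k : Fin 3) : MvPolynomial (Fin 3) ℂ :=
  ∑ j, MvPolynomial.C (h j k) * MvPolynomial.X j

theorem linForm_isHomogeneous (h : Matrix (Fin 3) (Fin 3) ℂ) (k : Fin 3) :
    (linForm h k).IsHomogeneous 1 :=
  MvPolynomial.IsHomogeneous.sum _ _ _ fun j _ => by
    simpa using (MvPolynomial.isHomogeneous_C (Fin 3) (h j k)).mul
      (MvPolynomial.isHomogeneous_X ℂ j)

/-- The action of `GL(V)` on `S³V`, induced by the action on `V`. -/
def cubicRep : Representation ℂ (GL (Fin 3) ℂ) Cubic where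
  toFun h :=
    ((MvPolynomial.aeval (linForm h.val)).toLinearMap).restrict fun F hF => by
      have := MvPolynomial.IsHomogeneous.aeval (R := ℂ) (φ := F) (m := 3) hF
        (linForm h.val) (n := 1) (linForm_isHomogeneous h.val)
      simpa using this
  map_one' := by
    ext1 F
    apply Subtype.ext
    have : linForm (1 : Matrix (Fin 3) (Fin 3) ℂ) = MvPolynomial.X := by
      funext k
      simp [linForm, Matrix.one_apply]
    simp [LinearMap.restrict_apply, this]
  map_mul' g h := by
    ext1 F
    apply Subtype.ext
    have key : (MvPolynomial.aeval (linForm (g * h).val) :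
        MvPolynomial (Fin 3) ℂ →ₐ[ℂ] MvPolynomial (Fin 3) ℂ) =
        (MvPolynomial.aeval (linForm g.val)).comp (MvPolynomial.aeval (linForm h.val)) := by
      apply MvPolynomial.algHom_ext
      intro k
      simp only [MvPolynomial.aeval_X, AlgHom.comp_apply, linForm, map_sum, map_mul,
        MvPolynomial.algHom_C, MvPolynomial.algebraMap_eq, Units.val_mul, Matrix.mul_apply,
        Finset.sum_mul, Finset.mul_sum]
      rw [Finset.sum_comm]
      refine Finset.sum_congr rfl fun i _ => Finset.sum_congr rfl fun j _ => ?_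
      ring
    exact congrArg (fun f => f F.1) key

/-- The symmetric matrix of a quadratic form `q`: `q(x) = xᵀ A x`. -/
def gram (q : Conic) : Matrix (Fin 3) (Fin 3) ℂ :=
  Matrix.of fun i j => QuadraticMap.polar q (Pi.single i 1) (Pi.single j 1) / 2

/-- The matrix `v₁A₁ + v₂A₂ + v₃A₃` of linear forms, where `A_k` is the symmetric matrix of the
`k`-th conic of the net. -/
def netMatrix (φ : Noc) : Matrix (Fin 3) (Fin 3) (MvPolynomial (Fin 3) ℂ) :=
  Matrix.of fun i j => ∑ k, MvPolynomial.C (gram (φ.conic k) i j) * MvPolynomial.X k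

theorem netMatrix_det_mem (φ : Noc) :
    (netMatrix φ).det ∈ MvPolynomial.homogeneousSubmodule (Fin 3) ℂ 3 := by
  have h1 : ∀ i j, (netMatrix φ i j).IsHomogeneous 1 := by
    intro i j
    refine MvPolynomial.IsHomogeneous.sum Finset.univ
      (fun k => MvPolynomial.C (gram (φ.conic k) i j) * MvPolynomial.X k) 1 fun k _ => ?_
    simpa using (MvPolynomial.isHomogeneous_C (Fin 3) (gram (φ.conic k) i j)).mul
      (MvPolynomial.isHomogeneous_X ℂ k)
  rw [Matrix.det_fin_three]
  have h3 : ∀ a b c d e f, (netMatrix φ a b * netMatrix φ c d * netMatrix φ e f) ∈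
      MvPolynomial.homogeneousSubmodule (Fin 3) ℂ 3 := fun a b c d e f =>
    ((h1 a b).mul (h1 c d)).mul (h1 e f)
  exact sub_mem (add_mem (add_mem (sub_mem (sub_mem (h3 ..) (h3 ..)) (h3 ..)) (h3 ..)) (h3 ..))
    (h3 ..)

/-- The determinant map `δ : Noc → S³V`. -/
def delta (φ : Noc) : Cubic := ⟨(netMatrix φ).det, netMatrix_det_mem φ⟩

/-- The coefficient of the monomial `v_i v_j v_k` of a cubic form. -/
def Cubic.coeff (F : Cubic) (i j k : Fin 3) : ℂ :=
  MvPolynomial.coeff (Finsupp.single i 1 + Finsupp.single j 1 + Finsupp.single k 1) F.1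

/-- Aronhold's invariant of degree 4 of the ternary cubic
`ax³ + by³ + cz³ + 3a₂x²y + 3a₃x²z + 3b₁xy² + 3b₃y²z + 3c₁xz² + 3c₂yz² + 6mxyz`,
scaled (by 27) so that its value on `y²z + x³ + αxz² + βz³` is `α`. -/
def aronhold (F : Cubic) : ℂ :=
  let a := F.coeff 0 0 0
  let b := F.coeff 1 1 1
  let c := F.coeff 2 2 2
  let a₂ := F.coeff 0 0 1 / 3
  let a₃ := F.coeff 0 0 2 / 3
  let b₁ := F.coeff 0 1 1 / 3
  let b₃ := F.coeff 1 1 2 / 3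
  let c₁ := F.coeff 0 2 2 / 3
  let c₂ := F.coeff 1 2 2 / 3
  let m := F.coeff 0 1 2 / 6
  27 * (a * b * c * m - (b * c * a₂ * a₃ + c * a * b₁ * b₃ + a * b * c₁ * c₂)
    - m * (a * b₃ * c₂ + b * c₁ * a₃ + c * a₂ * b₁)
    + (a * b₁ * c₂ ^ 2 + a * c₁ * b₃ ^ 2 + b * a₂ * c₁ ^ 2 + b * c₂ * a₃ ^ 2
      + c * b₃ * a₂ ^ 2 + c * a₃ * b₁ ^ 2)
    - m ^ 4 + 2 * m ^ 2 * (b₁ * c₁ + c₂ * a₂ + a₃ * b₃)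
    - 3 * m * (a₂ * b₃ * c₁ + a₃ * b₁ * c₂)
    - (b₁ ^ 2 * c₁ ^ 2 + c₂ ^ 2 * a₂ ^ 2 + a₃ ^ 2 * b₃ ^ 2)
    + (c₂ * a₂ * a₃ * b₃ + a₃ * b₃ * b₁ * c₁ + b₁ * c₁ * c₂ * a₂))

/-- The cubic monomial `v_i v_j v_k`. -/
def cubicMonom (i j k : Fin 3) : Cubic :=
  ⟨MvPolynomial.X i * MvPolynomial.X j * MvPolynomial.X k,
    ((MvPolynomial.isHomogeneous_X ℂ i).mul (MvPolynomial.isHomogeneous_X ℂ j)).mul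
      (MvPolynomial.isHomogeneous_X ℂ k)⟩

/-- The Weierstrass form `y²z + x³ + αxz² + βz³`. -/
def weierstrass (α β : ℂ) : Cubic :=
  cubicMonom 1 1 2 + cubicMonom 0 0 0 + α • cubicMonom 0 2 2 + β • cubicMonom 2 2 2

/-- `J₁₂ = -48 δ*a`. -/
def J₁₂ (φ : Noc) : ℂ := -48 * aronhold (delta φ)

end NetsOfConics

end

/-! Everything rests on restriction to the slice of the nets `nu c g`. Translating the slice by
pairs of invertible matrices gives a map $(A,B,c,g)\mapsto B\circ\nu_{c,g}\circ A$ from a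
20-dimensional to an 18-dimensional space, and its differential at $(1,1,0,0)$ is onto. By the
inverse function theorem the translates contain a neighbourhood of $\nu_{0,0}$. Determinants can be
normalized to 1 at the cost of a scalar, and the scalar multiple $s\,\nu_{c,g}$ is an
$\mathrm{SL}\times\mathrm{SL}$-translate of $\nu_{s^{12}c,\,s^6g}$ (`smul_nu`). So an invariant
polynomial that vanishes on the slice vanishes on an open set, hence everywhere
(`eq_zero_of_eq_zero_on_slice`): restriction embeds the ring of invariants in $\mathbb C[c,g]$. As
`J₆` and `J₁₂` restrict to $24g$ and $-48(c-3g^2)$, which freely generate $\mathbb C[c,g]$, the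
embedding is an isomorphism and both freeness and generation follow.

That `J₆` and `J₁₂` are relative invariants reduces, through the equivariance of the Plücker map and
of `delta`, to `I₂_map_substitute` and `aronhold_cubicSubstitute`. These are checked on diagonal
matrices and transvections, whose products give all matrices.

Every homomorphism from $\mathrm{GL}_3\times\mathrm{GL}_3$ to an abelian group kills
$\mathrm{SL}_3\times\mathrm{SL}_3$ (`hom_slToGL`), so semi-invariants are invariants. Conversely,
monomials in `J₆` and `J₁₂` are relative invariants, and they span the ring. -/

noncomputable section

namespace NetsOfConics

/-! ### Homomorphisms from `GL₃` to abelian groups -/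

section Characters

open Matrix

variable {A : Type*} [CommGroup A] (χ : GL (Fin 3) ℂ →* A)

include χ in
theorem hom_eq_of_mul_eq_mul {u v w : GL (Fin 3) ℂ} (h : w * u = v * w) : χ u = χ v := by
  have := congrArg χ h
  rw [map_mul, map_mul, mul_comm (χ v)] at this
  exact mul_left_cancel this

/-- Conjugation by the diagonal matrix with 2 in position `i` doubles the parameter of the
transvection, that is, turns `u` into `u * u`. Hence `χ u = χ u ^ 2`. -/
theorem hom_transvection (t : TransvectionStruct (Fin 3) ℂ) (u : GL (Fin 3) ℂ)
    (hu : u.val = t.toMatrix) : χ u = 1 := by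
  obtain ⟨i, j, hij, c⟩ := t
  have hdet : (diagonal (fun k => if k = i then (2 : ℂ) else 1)).det ≠ 0 := by
    rw [det_diagonal, Finset.prod_ite_eq' Finset.univ i (fun _ => (2 : ℂ))]
    simp
  have h := hom_eq_of_mul_eq_mul χ (u := u) (v := u * u)
    (w := GeneralLinearGroup.mkOfDetNeZero _ hdet) (by
      apply Units.ext
      have h2 : (u * u).val = transvection i j (c + c) := by
        rw [Units.val_mul, hu]
        exact transvection_mul_transvection_same i j hij c c
      rw [Units.val_mul, Units.val_mul, h2, hu]
      change diagonal _ * transvection i j c = transvection i j (c + c) * diagonal _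
      simp only [transvection, mul_add, add_mul, mul_one, one_mul]
      congr 1
      ext a b
      simp only [diagonal_mul, mul_diagonal, single_apply]
      by_cases ha : i = a <;> by_cases hb : j = b <;> simp [ha, hb]
      · subst ha hb
        simp [Ne.symm hij]
        ring)
  simpa using h

/-- Since $d_0d_1d_2=1$, multiplication by $D$ takes $E=\mathrm{diag}(1,d_0,d_0d_1)$ to
$E'=\mathrm{diag}(d_0,d_0d_1,1)$. This is a cyclic rearrangement of $E$, conjugate to it by the
permutation matrix $S$, so `χ E = χ E'`. -/
theorem hom_diagonal (D : Fin 3 → ℂ) (hD : (diagonal D).det = 1) (u : GL (Fin 3) ℂ)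
    (hu : u.val = diagonal D) : χ u = 1 := by
  have hD' : D 0 * D 1 * D 2 = 1 := by simpa [det_diagonal, Fin.prod_univ_three] using hD
  have h0 : D 0 ≠ 0 := by rintro h; simp [h] at hD'
  have h1 : D 1 ≠ 0 := by rintro h; simp [h] at hD'
  let E := GeneralLinearGroup.mkOfDetNeZero (diagonal ![1, D 0, D 0 * D 1])
    (by simp [det_diagonal, Fin.prod_univ_three, h0, h1])
  let E' := GeneralLinearGroup.mkOfDetNeZero (diagonal ![D 0, D 0 * D 1, 1])
    (by simp [det_diagonal, Fin.prod_univ_three, h0, h1])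
  let S := GeneralLinearGroup.mkOfDetNeZero (!![0, 1, 0; 0, 0, 1; 1, 0, 0] : Matrix _ _ ℂ)
    (by simp [det_fin_three])
  have h : χ E = χ E' := hom_eq_of_mul_eq_mul χ (w := S) (by
    apply Units.ext
    change !![0, 1, 0; 0, 0, 1; 1, 0, 0] * diagonal ![1, D 0, D 0 * D 1] =
      diagonal ![D 0, D 0 * D 1, 1] * !![0, 1, 0; 0, 0, 1; 1, 0, 0]
    ext a b
    fin_cases a <;> fin_cases b <;> simp [mul_diagonal, diagonal_mul])
  have h' : u * E = E' := by
    apply Units.ext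
    rw [Units.val_mul, hu]
    change diagonal D * diagonal ![1, D 0, D 0 * D 1] = diagonal ![D 0, D 0 * D 1, 1]
    rw [diagonal_mul_diagonal]
    congr 1
    ext a
    fin_cases a
    · simp
    · simp [mul_comm (D 1)]
    · simpa [mul_comm] using hD'
  have := congrArg χ h'
  rw [map_mul, h] at this
  simpa using this

theorem hom_eq_one_of_det_eq_one (u : GL (Fin 3) ℂ) (hu : u.val.det = 1) : χ u = 1 := by
  -- The condition `M.det = 1` is carried along so that both factors of a product are invertible and
  -- lift to the group.
  have key := diagonal_transvection_induction
    (fun M : Matrix (Fin 3) (Fin 3) ℂ => M.det = 1 ∧ ∀ u : GL (Fin 3) ℂ, u.val = M → χ u = 1)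
    u.val (fun D hD => ⟨hD.trans hu, hom_diagonal χ D (hD.trans hu)⟩)
    (fun t => ⟨t.det, hom_transvection χ t⟩) (by
      rintro M N ⟨hM, hM'⟩ ⟨hN, hN'⟩
      refine ⟨by simp [hM, hN], fun u hu => ?_⟩
      have : u = GeneralLinearGroup.mkOfDetNeZero M (by simp [hM]) *
          GeneralLinearGroup.mkOfDetNeZero N (by simp [hN]) := Units.ext hu
      rw [this, map_mul, hM' _ rfl, hN' _ rfl, one_mul])
  exact key.2 u rfl

end Characters

theorem hom_slToGL {A : Type*} [CommGroup A] (χ : GLGL →* A) (p : SLSL) : χ (slToGL p) = 1 := by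
  have h : slToGL p = (MonoidHom.inl _ _ (Matrix.SpecialLinearGroup.toGL p.1)) *
      (MonoidHom.inr _ _ (Matrix.SpecialLinearGroup.toGL p.2)) := by
    ext1 <;> simp [slToGL]
  rw [h, map_mul]
  have h1 := hom_eq_one_of_det_eq_one (χ.comp (MonoidHom.inl _ _))
    (Matrix.SpecialLinearGroup.toGL p.1) p.1.2
  have h2 := hom_eq_one_of_det_eq_one (χ.comp (MonoidHom.inr _ _))
    (Matrix.SpecialLinearGroup.toGL p.2) p.2.2
  rw [MonoidHom.comp_apply] at h1 h2
  rw [h1, h2, one_mul]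

/-! ### Polynomial functions -/

section Polynomial

variable {W W' : Type*} [AddCommGroup W] [Module ℂ W] [AddCommGroup W'] [Module ℂ W']

theorem dual_mem_coordinateRing (l : Module.Dual ℂ W) : (fun w => l w) ∈ coordinateRing W :=
  Algebra.subset_adjoin ⟨l, rfl⟩

theorem const_mem_coordinateRing (c : ℂ) : (fun _ : W => c) ∈ coordinateRing W :=
  Subalgebra.algebraMap_mem _ c

theorem add_mem_coordinateRing {f g : W → ℂ} (hf : f ∈ coordinateRing W)
    (hg : g ∈ coordinateRing W) : (fun w => f w + g w) ∈ coordinateRing W := add_mem hf hg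

theorem sub_mem_coordinateRing {f g : W → ℂ} (hf : f ∈ coordinateRing W)
    (hg : g ∈ coordinateRing W) : (fun w => f w - g w) ∈ coordinateRing W := sub_mem hf hg

theorem mul_mem_coordinateRing {f g : W → ℂ} (hf : f ∈ coordinateRing W)
    (hg : g ∈ coordinateRing W) : (fun w => f w * g w) ∈ coordinateRing W := mul_mem hf hg

theorem pow_mem_coordinateRing {f : W → ℂ} (hf : f ∈ coordinateRing W) (n : ℕ) :
    (fun w => f w ^ n) ∈ coordinateRing W := pow_mem hf n

/-- The restriction of a polynomial function to an affine line is a polynomial. -/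
theorem exists_polynomial_line {f : W → ℂ} (hf : f ∈ coordinateRing W) (p v : W) :
    ∃ P : Polynomial ℂ, ∀ t : ℂ, f (p + t • v) = P.eval t := by
  induction hf using Algebra.adjoin_induction with
  | mem f hf =>
    obtain ⟨l, rfl⟩ := hf
    refine ⟨Polynomial.C (l p) + Polynomial.X * Polynomial.C (l v), fun t => ?_⟩
    simp
    ring
  | algebraMap r => exact ⟨Polynomial.C r, fun t => by simp [Pi.algebraMap_apply]⟩
  | add f g _ _ hf hg =>
    obtain ⟨P, hP⟩ := hf
    obtain ⟨Q, hQ⟩ := hg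
    exact ⟨P + Q, fun t => by simp [hP, hQ]⟩
  | mul f g _ _ hf hg =>
    obtain ⟨P, hP⟩ := hf
    obtain ⟨Q, hQ⟩ := hg
    exact ⟨P * Q, fun t => by simp [hP, hQ]⟩

/-- The restriction of a polynomial function to an affine plane is a polynomial. -/
theorem exists_mvPolynomial_plane {f : W → ℂ} (hf : f ∈ coordinateRing W) (p v w : W) :
    ∃ P : MvPolynomial (Fin 2) ℂ, ∀ x : Fin 2 → ℂ,
      f (p + x 0 • v + x 1 • w) = MvPolynomial.eval x P := by
  induction hf using Algebra.adjoin_induction with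
  | mem f hf =>
    obtain ⟨l, rfl⟩ := hf
    refine ⟨MvPolynomial.C (l p) + MvPolynomial.X 0 * MvPolynomial.C (l v) +
      MvPolynomial.X 1 * MvPolynomial.C (l w), fun t => ?_⟩
    simp
  | algebraMap r => exact ⟨MvPolynomial.C r, fun t => by simp [Pi.algebraMap_apply]⟩
  | add f g _ _ hf hg =>
    obtain ⟨P, hP⟩ := hf
    obtain ⟨Q, hQ⟩ := hg
    exact ⟨P + Q, fun t => by simp [hP, hQ]⟩
  | mul f g _ _ hf hg =>
    obtain ⟨P, hP⟩ := hf
    obtain ⟨Q, hQ⟩ := hg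
    exact ⟨P * Q, fun t => by simp [hP, hQ]⟩

/-- A polynomial function that vanishes near a point vanishes identically. -/
theorem eq_zero_of_eventually_eq_zero {E : Type*} [NormedAddCommGroup E] [NormedSpace ℂ E]
    (T : E →ₗ[ℂ] W) (hT : Function.Surjective T) {f : W → ℂ} (hf : f ∈ coordinateRing W) (p : E)
    (h : ∀ᶠ x in nhds p, f (T x) = 0) : f = 0 := by
  funext w
  obtain ⟨v, rfl⟩ := hT w
  -- On the line from `p` to `v` the function is a polynomial in one variable that vanishes near 0,
  -- so it has infinitely many roots and is zero; the parameter 1 gives the point `v`.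
  obtain ⟨P, hP⟩ := exists_polynomial_line hf (T p) (T (v - p))
  have htend : Filter.Tendsto (fun t : ℂ => p + t • (v - p)) (nhds 0) (nhds p) := by
    have : Continuous (fun t : ℂ => p + t • (v - p)) := by fun_prop
    simpa using this.tendsto 0
  have hev : ∀ᶠ t in nhds (0 : ℂ), P.eval t = 0 := by
    filter_upwards [htend.eventually h] with t ht
    rw [← hP, ← map_smul, ← map_add, ht]
  have hP0 : P = 0 := by
    refine Polynomial.eq_zero_of_infinite_isRoot P ?_
    exact infinite_of_mem_nhds 0 hev
  have := hP 1
  simpa [hP0] using this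

/-- The polynomial functions with values in a polynomial ring: those with polynomial
coefficients. -/
def IsPolynomialFamily (p : W → MvPolynomial (Fin 3) ℂ) : Prop :=
  ∀ m, (fun w => MvPolynomial.coeff m (p w)) ∈ coordinateRing W

theorem IsPolynomialFamily.add {p q : W → MvPolynomial (Fin 3) ℂ} (hp : IsPolynomialFamily p)
    (hq : IsPolynomialFamily q) : IsPolynomialFamily (fun w => p w + q w) := fun m => by
  simp only [MvPolynomial.coeff_add]
  exact add_mem (hp m) (hq m)

theorem IsPolynomialFamily.sub {p q : W → MvPolynomial (Fin 3) ℂ} (hp : IsPolynomialFamily p)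
    (hq : IsPolynomialFamily q) : IsPolynomialFamily (fun w => p w - q w) := fun m => by
  simp only [MvPolynomial.coeff_sub]
  exact sub_mem (hp m) (hq m)

theorem IsPolynomialFamily.mul {p q : W → MvPolynomial (Fin 3) ℂ} (hp : IsPolynomialFamily p)
    (hq : IsPolynomialFamily q) : IsPolynomialFamily (fun w => p w * q w) := fun m => by
  classical
  simp only [MvPolynomial.coeff_mul]
  have := sum_mem (t := Finset.HasAntidiagonal.antidiagonal m) (fun x _ => mul_mem (hp x.1) (hq x.2))
  convert this using 1
  ext w
  simp

theorem IsPolynomialFamily.sum {p : Fin 3 → W → MvPolynomial (Fin 3) ℂ}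
    (hp : ∀ k, IsPolynomialFamily (p k)) : IsPolynomialFamily (fun w => ∑ k, p k w) := by
  simp only [Fin.sum_univ_three]
  exact ((hp 0).add (hp 1)).add (hp 2)

theorem IsPolynomialFamily.C_mul {f : W → ℂ} (hf : f ∈ coordinateRing W)
    (p : MvPolynomial (Fin 3) ℂ) :
    IsPolynomialFamily (fun w => MvPolynomial.C (f w) * p) := fun m => by
  simp only [MvPolynomial.coeff_C_mul]
  exact mul_mem hf (const_mem_coordinateRing _)

end Polynomial

/-! ### Substitutions in conics and Plücker coordinates -/

open Matrix

/-- The linear substitution `q ↦ q ∘ A`. -/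
def substitute (A : Matrix (Fin 3) (Fin 3) ℂ) : Conic →ₗ[ℂ] Conic where
  toFun q := q.comp (Matrix.toLin' A)
  map_add' _ _ := rfl
  map_smul' _ _ := rfl

theorem conicRep_eq_substitute (g : GL (Fin 3) ℂ) : conicRep g = substitute (g⁻¹).val := rfl

theorem substitute_apply (A : Matrix (Fin 3) (Fin 3) ℂ) (q : Conic) (x : Fin 3 → ℂ) :
    substitute A q x = q (A *ᵥ x) := rfl

theorem substitute_mul (A B : Matrix (Fin 3) (Fin 3) ℂ) :
    substitute (A * B) = substitute B ∘ₗ substitute A := by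
  ext q x
  simp [substitute_apply]

theorem conic_apply (q : Conic) (x : Fin 3 → ℂ) :
    q x = x 0 ^ 2 * tcoord 1 q + x 0 * x 1 * tcoord 2 q + x 0 * x 2 * tcoord 3 q +
      x 1 ^ 2 * tcoord 4 q + x 1 * x 2 * tcoord 5 q + x 2 ^ 2 * tcoord 6 q := by
  have hx : x = x 0 • Pi.single 0 1 + x 1 • Pi.single 1 1 + x 2 • Pi.single 2 1 := by
    ext i
    fin_cases i <;> simp
  conv_lhs => rw [hx]
  rw [QuadraticMap.map_add q, QuadraticMap.map_add q]
  simp only [QuadraticMap.polar_add_left, QuadraticMap.polar_smul_left,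
    QuadraticMap.polar_smul_right, QuadraticMap.map_smul, smul_eq_mul, tcoord, coeffSq, coeffMixed,
    LinearMap.coe_mk, AddHom.coe_mk]
  ring

theorem coeffSq_substitute (A : Matrix (Fin 3) (Fin 3) ℂ) (i : Fin 3) :
    coeffSq i ∘ₗ substitute A = A 0 i ^ 2 • tcoord 1 + (A 0 i * A 1 i) • tcoord 2 +
      (A 0 i * A 2 i) • tcoord 3 + A 1 i ^ 2 • tcoord 4 + (A 1 i * A 2 i) • tcoord 5 +
      A 2 i ^ 2 • tcoord 6 := by
  ext q
  have h : (coeffSq i ∘ₗ substitute A) q = q (A *ᵥ Pi.single i 1) := rfl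
  rw [h, conic_apply q]
  simp

theorem coeffMixed_substitute (A : Matrix (Fin 3) (Fin 3) ℂ) (i j : Fin 3) :
    coeffMixed i j ∘ₗ substitute A =
      (2 * A 0 i * A 0 j) • tcoord 1 + (A 0 i * A 1 j + A 1 i * A 0 j) • tcoord 2 +
      (A 0 i * A 2 j + A 2 i * A 0 j) • tcoord 3 + (2 * A 1 i * A 1 j) • tcoord 4 +
      (A 1 i * A 2 j + A 2 i * A 1 j) • tcoord 5 + (2 * A 2 i * A 2 j) • tcoord 6 := by
  ext q
  have h : (coeffMixed i j ∘ₗ substitute A) q =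
      q (A *ᵥ (Pi.single i 1 + Pi.single j 1)) - q (A *ᵥ Pi.single i 1) -
        q (A *ᵥ Pi.single j 1) := rfl
  rw [h, conic_apply q, conic_apply q, conic_apply q]
  simp [Matrix.mulVec_add]
  ring

/-- The value of `a ∧ b ∧ c` at a point of the Plücker space. -/
def wedgeEval (w : PluckerSpace) (a b c : Module.Dual ℂ Conic) : ℂ :=
  exteriorPower.pairingDual ℂ Conic 3 (exteriorPower.ιMulti ℂ 3 ![a, b, c]) w

theorem tc_eq_wedgeEval (i j k : ℕ) (w : PluckerSpace) :
    tc i j k w = wedgeEval w (tcoord i) (tcoord j) (tcoord k) := rfl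

/-- Both sides are linear in `w`, and on decomposable elements they are the same determinant. -/
theorem wedgeEval_map (L : Conic →ₗ[ℂ] Conic) (w : PluckerSpace) (a b c : Module.Dual ℂ Conic) :
    wedgeEval (exteriorPower.map 3 L w) a b c = wedgeEval w (a ∘ₗ L) (b ∘ₗ L) (c ∘ₗ L) := by
  have h : exteriorPower.pairingDual ℂ Conic 3 (exteriorPower.ιMulti ℂ 3 ![a, b, c]) ∘ₗ
      exteriorPower.map 3 L = exteriorPower.pairingDual ℂ Conic 3
        (exteriorPower.ιMulti ℂ 3 ![a ∘ₗ L, b ∘ₗ L, c ∘ₗ L]) := by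
    apply exteriorPower.linearMap_ext
    ext v
    simp [Matrix.det_fin_three, exteriorPower.map_apply_ιMulti]
  exact congrArg (fun f => f w) h

section wedgeEval

variable (w : PluckerSpace) (a a' b c : Module.Dual ℂ Conic) (s : ℂ)

theorem wedgeEval_swap₁₂ : wedgeEval w a b c = -wedgeEval w b a c := by
  have h : ![a, b, c] = ![b, a, c] ∘ Equiv.swap (0 : Fin 3) 1 := by
    ext i
    fin_cases i <;> simp [Equiv.swap_apply_of_ne_of_ne]
  rw [wedgeEval, h, AlternatingMap.map_swap _ _ (by decide)]
  simp [wedgeEval]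

theorem wedgeEval_swap₂₃ : wedgeEval w a b c = -wedgeEval w a c b := by
  have h : ![a, b, c] = ![a, c, b] ∘ Equiv.swap (1 : Fin 3) 2 := by
    ext i
    fin_cases i <;> simp [Equiv.swap_apply_of_ne_of_ne]
  rw [wedgeEval, h, AlternatingMap.map_swap _ _ (by decide)]
  simp [wedgeEval]

theorem wedgeEval_add₁ : wedgeEval w (a + a') b c = wedgeEval w a b c + wedgeEval w a' b c := by
  simp [wedgeEval, AlternatingMap.map_vecCons_add]

theorem wedgeEval_smul₁ : wedgeEval w (s • a) b c = s * wedgeEval w a b c := by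
  simp [wedgeEval, AlternatingMap.map_vecCons_smul]

theorem wedgeEval_add₂ : wedgeEval w b (a + a') c = wedgeEval w b a c + wedgeEval w b a' c := by
  rw [wedgeEval_swap₁₂, wedgeEval_add₁, wedgeEval_swap₁₂ w a, wedgeEval_swap₁₂ w a']
  ring

theorem wedgeEval_smul₂ : wedgeEval w b (s • a) c = s * wedgeEval w b a c := by
  rw [wedgeEval_swap₁₂, wedgeEval_smul₁, wedgeEval_swap₁₂ w a]
  ring

theorem wedgeEval_add₃ : wedgeEval w b c (a + a') = wedgeEval w b c a + wedgeEval w b c a' := by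
  rw [wedgeEval_swap₂₃, wedgeEval_add₂, wedgeEval_swap₂₃ w b a, wedgeEval_swap₂₃ w b a']
  ring

theorem wedgeEval_smul₃ : wedgeEval w b c (s • a) = s * wedgeEval w b c a := by
  rw [wedgeEval_swap₂₃, wedgeEval_smul₂, wedgeEval_swap₂₃ w b a]
  ring

theorem wedgeEval_self₁₂ : wedgeEval w a a b = 0 := by
  have := wedgeEval_swap₁₂ w a a b
  linear_combination this / 2

theorem wedgeEval_self₂₃ : wedgeEval w a b b = 0 := by
  have := wedgeEval_swap₂₃ w a b b
  linear_combination this / 2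

theorem wedgeEval_self₁₃ : wedgeEval w a b a = 0 := by
  rw [wedgeEval_swap₂₃, wedgeEval_self₁₂, neg_zero]

/-- As rewrite rules, this and the next apply only to neighbouring indices in decreasing order, so
rewriting stops at increasing Plücker coordinates. -/
theorem wedgeEval_sort₁₂ {i j k : ℕ} (_ : j < i) :
    wedgeEval w (tcoord i) (tcoord j) (tcoord k) =
      -wedgeEval w (tcoord j) (tcoord i) (tcoord k) := wedgeEval_swap₁₂ ..

theorem wedgeEval_sort₂₃ {i j k : ℕ} (_ : k < j) :
    wedgeEval w (tcoord i) (tcoord j) (tcoord k) =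
      -wedgeEval w (tcoord i) (tcoord k) (tcoord j) := wedgeEval_swap₂₃ ..

end wedgeEval

/-! ### Relative invariance of `I₂` -/

theorem tcoord_substitute (A : Matrix (Fin 3) (Fin 3) ℂ) :
    tcoord 1 ∘ₗ substitute A = coeffSq 0 ∘ₗ substitute A ∧
    tcoord 2 ∘ₗ substitute A = coeffMixed 0 1 ∘ₗ substitute A ∧
    tcoord 3 ∘ₗ substitute A = coeffMixed 0 2 ∘ₗ substitute A ∧
    tcoord 4 ∘ₗ substitute A = coeffSq 1 ∘ₗ substitute A ∧
    tcoord 5 ∘ₗ substitute A = coeffMixed 1 2 ∘ₗ substitute A ∧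
    tcoord 6 ∘ₗ substitute A = coeffSq 2 ∘ₗ substitute A := ⟨rfl, rfl, rfl, rfl, rfl, rfl⟩

/-- Every product of two Plücker coordinates in `I₂` has weight 4 in each of the three variables. -/
theorem I₂_map_diagonal (D : Fin 3 → ℂ) (w : PluckerSpace) :
    I₂ (exteriorPower.map 3 (substitute (diagonal D)) w) = (diagonal D).det ^ 4 * I₂ w := by
  obtain ⟨h1, h2, h3, h4, h5, h6⟩ := tcoord_substitute (diagonal D)
  simp only [coeffSq_substitute, coeffMixed_substitute] at h1 h2 h3 h4 h5 h6
  simp at h1 h2 h3 h4 h5 h6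
  simp only [I₂, tc_eq_wedgeEval, wedgeEval_map, h1, h2, h3, h4, h5, h6, wedgeEval_smul₁,
    wedgeEval_smul₂, wedgeEval_smul₃, det_diagonal, Fin.prod_univ_three]
  ring

/-- This is where the coefficients of `I₂` matter. For each of the six positions, the transformed
coordinates are expanded by multilinearity, sorted by antisymmetry and compared as polynomials in
the remaining Plücker coordinates. -/
theorem I₂_map_transvection (t : TransvectionStruct (Fin 3) ℂ) (w : PluckerSpace) :
    I₂ (exteriorPower.map 3 (substitute t.toMatrix) w) = I₂ w := by
  obtain ⟨i, j, hij, s⟩ := t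
  obtain ⟨h1, h2, h3, h4, h5, h6⟩ :=
    tcoord_substitute (TransvectionStruct.toMatrix ⟨i, j, hij, s⟩)
  simp only [coeffSq_substitute, coeffMixed_substitute] at h1 h2 h3 h4 h5 h6
  simp only [TransvectionStruct.toMatrix, transvection, Matrix.add_apply, Matrix.one_apply,
    Matrix.single_apply] at h1 h2 h3 h4 h5 h6
  simp only [I₂, tc_eq_wedgeEval, wedgeEval_map]
  fin_cases i <;> fin_cases j <;> first | exact absurd rfl hij | skip
  all_goals
    simp at h1 h2 h3 h4 h5 h6
    simp only [TransvectionStruct.toMatrix, Fin.mk_zero, Fin.mk_one, Fin.reduceFinMk, transvection]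
    simp only [h1, h2, h3, h4, h5, h6]
    simp only [wedgeEval_smul₁, wedgeEval_smul₂, wedgeEval_smul₃, wedgeEval_add₁, wedgeEval_add₂,
      wedgeEval_add₃, wedgeEval_self₁₂, wedgeEval_self₂₃, wedgeEval_self₁₃]
    simp (disch := norm_num) only [wedgeEval_sort₁₂, wedgeEval_sort₂₃]
    ring

theorem I₂_map_substitute (A : Matrix (Fin 3) (Fin 3) ℂ) (w : PluckerSpace) :
    I₂ (exteriorPower.map 3 (substitute A) w) = A.det ^ 4 * I₂ w := by
  refine diagonal_transvection_induction
    (fun A => ∀ w, I₂ (exteriorPower.map 3 (substitute A) w) = A.det ^ 4 * I₂ w) A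
    (fun D _ => I₂_map_diagonal D) (fun t w => by simp [I₂_map_transvection]) ?_ w
  intro A B hA hB w
  rw [substitute_mul, exteriorPower.map_comp, LinearMap.comp_apply, hB, hA, det_mul]
  ring

theorem I₂_smul (s : ℂ) (w : PluckerSpace) : I₂ (s • w) = s ^ 2 * I₂ w := by
  simp only [I₂, map_smul, smul_eq_mul]
  ring

theorem I₂_pluckerRep (p : GLGL) (w : PluckerSpace) :
    I₂ (pluckerRep p w) = p.1.val.det⁻¹ ^ 4 * p.2.val.det ^ 2 * I₂ w := by
  change I₂ (p.2.val.det • exteriorPower.map 3 (conicRep p.1) w) = _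
  rw [I₂_smul, conicRep_eq_substitute, I₂_map_substitute, Matrix.coe_units_inv,
    Matrix.det_nonsing_inv, Ring.inverse_eq_inv']
  ring

theorem I₂_mem_coordinateRing : I₂ ∈ coordinateRing PluckerSpace := by
  unfold I₂
  repeat' first
    | exact dual_mem_coordinateRing _
    | exact const_mem_coordinateRing _
    | apply pow_mem_coordinateRing
    | apply add_mem_coordinateRing
    | apply sub_mem_coordinateRing
    | apply mul_mem_coordinateRing

/-! ### Ternary cubics -/

/-- The cubic `a vᵢ³ + b vⱼ³ + c vₖ³ + 3a₂ vᵢ²vⱼ + ⋯ + 6m vᵢvⱼvₖ`. -/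
def cubicSum (i j k : Fin 3) (a b c a₂ a₃ b₁ b₃ c₁ c₂ m : ℂ) : Cubic :=
  a • cubicMonom i i i + b • cubicMonom j j j + c • cubicMonom k k k +
    (3 * a₂) • cubicMonom i i j + (3 * a₃) • cubicMonom i i k + (3 * b₁) • cubicMonom i j j +
    (3 * b₃) • cubicMonom j j k + (3 * c₁) • cubicMonom i k k + (3 * c₂) • cubicMonom j k k +
    (6 * m) • cubicMonom i j k

/-- Aronhold's invariant in terms of normalized coefficients. -/
def aronholdPoly (a b c a₂ a₃ b₁ b₃ c₁ c₂ m : ℂ) : ℂ :=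
  27 * (a * b * c * m - (b * c * a₂ * a₃ + c * a * b₁ * b₃ + a * b * c₁ * c₂)
    - m * (a * b₃ * c₂ + b * c₁ * a₃ + c * a₂ * b₁)
    + (a * b₁ * c₂ ^ 2 + a * c₁ * b₃ ^ 2 + b * a₂ * c₁ ^ 2 + b * c₂ * a₃ ^ 2
      + c * b₃ * a₂ ^ 2 + c * a₃ * b₁ ^ 2)
    - m ^ 4 + 2 * m ^ 2 * (b₁ * c₁ + c₂ * a₂ + a₃ * b₃)
    - 3 * m * (a₂ * b₃ * c₁ + a₃ * b₁ * c₂)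
    - (b₁ ^ 2 * c₁ ^ 2 + c₂ ^ 2 * a₂ ^ 2 + a₃ ^ 2 * b₃ ^ 2)
    + (c₂ * a₂ * a₃ * b₃ + a₃ * b₃ * b₁ * c₁ + b₁ * c₁ * c₂ * a₂))

theorem aronhold_eq_aronholdPoly (F : Cubic) : aronhold F =
    aronholdPoly (F.coeff 0 0 0) (F.coeff 1 1 1) (F.coeff 2 2 2) (F.coeff 0 0 1 / 3)
      (F.coeff 0 0 2 / 3) (F.coeff 0 1 1 / 3) (F.coeff 1 1 2 / 3) (F.coeff 0 2 2 / 3)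
      (F.coeff 1 2 2 / 3) (F.coeff 0 1 2 / 6) := rfl

theorem Cubic.coeff_add (F G : Cubic) (i j k : Fin 3) :
    (F + G).coeff i j k = F.coeff i j k + G.coeff i j k := by
  simp [Cubic.coeff]

theorem Cubic.coeff_smul (s : ℂ) (F : Cubic) (i j k : Fin 3) :
    (s • F).coeff i j k = s * F.coeff i j k := by
  simp [Cubic.coeff]

/-- Two monomials agree when each variable occurs equally often in both; stated by counts, this is
decidable for concrete indices. -/
theorem coeff_cubicMonom (i j k a b c : Fin 3) :
    (cubicMonom i j k).coeff a b c =
      if ∀ t : Fin 3, [i, j, k].count t = [a, b, c].count t then 1 else 0 := by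
  have h : (cubicMonom i j k).1 = MvPolynomial.monomial
      (Finsupp.single i 1 + Finsupp.single j 1 + Finsupp.single k 1) 1 := by
    simp [cubicMonom, MvPolynomial.X, MvPolynomial.monomial_mul]
  rw [Cubic.coeff, h, MvPolynomial.coeff_monomial]
  congr 1
  rw [Finsupp.ext_iff]
  simp only [Finsupp.add_apply, Finsupp.single_apply, List.count_cons, List.count_nil, beq_iff_eq,
    zero_add, eq_iff_iff]
  refine forall_congr' fun t => ?_
  constructor <;> intro h <;> omega

theorem exponent_cases (d : Fin 3 →₀ ℕ) (hd : d.degree = 3) :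
    ∃ i j k : Fin 3, i ≤ j ∧ j ≤ k ∧
      d = Finsupp.single i 1 + Finsupp.single j 1 + Finsupp.single k 1 := by
  have h : d 0 + d 1 + d 2 = 3 := by
    rwa [Finsupp.degree_eq_sum, Fin.sum_univ_three] at hd
  have hx : ∀ i j k : Fin 3,
      (∀ t, d t = (if i = t then 1 else 0) + (if j = t then 1 else 0) + if k = t then 1 else 0) →
      d = Finsupp.single i 1 + Finsupp.single j 1 + Finsupp.single k 1 := by
    intro i j k h
    ext t
    rw [h]
    simp [Finsupp.single_apply]
  have hcases : ∃ i j k : Fin 3, i ≤ j ∧ j ≤ k ∧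
      d 0 = [i, j, k].count 0 ∧ d 1 = [i, j, k].count 1 ∧ d 2 = [i, j, k].count 2 := by
    have h0 : d 0 ≤ 3 := by omega
    have h1 : d 1 ≤ 3 := by omega
    have h2 : d 2 = 3 - d 0 - d 1 := by omega
    have h3 : d 0 + d 1 ≤ 3 := by omega
    rw [h2]
    -- With the third exponent expressed through the first two, finitely many cases are left.
    generalize d 0 = x at *
    generalize d 1 = y at *
    clear h h2 hx hd
    interval_cases x <;> interval_cases y <;> first | omega | decide
  obtain ⟨i, j, k, hij, hjk, e0, e1, e2⟩ := hcases
  refine ⟨i, j, k, hij, hjk, hx i j k fun t => ?_⟩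
  have : ∀ t, d t = [i, j, k].count t := by
    intro t
    fin_cases t <;> assumption
  rw [this]
  simp only [List.count_cons, List.count_nil, beq_iff_eq]
  omega

theorem Cubic.ext_coeff {F G : Cubic}
    (h : ∀ i j k : Fin 3, i ≤ j → j ≤ k → F.coeff i j k = G.coeff i j k) : F = G := by
  apply Subtype.ext
  ext d
  by_cases hd : d.degree = 3
  · obtain ⟨i, j, k, hij, hjk, rfl⟩ := exponent_cases d hd
    exact h i j k hij hjk
  · rw [MvPolynomial.IsHomogeneous.coeff_eq_zero F.2 hd,
      MvPolynomial.IsHomogeneous.coeff_eq_zero G.2 hd]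

theorem Cubic.eq_cubicSum (F : Cubic) :
    F = cubicSum 0 1 2 (F.coeff 0 0 0) (F.coeff 1 1 1) (F.coeff 2 2 2) (F.coeff 0 0 1 / 3)
      (F.coeff 0 0 2 / 3) (F.coeff 0 1 1 / 3) (F.coeff 1 1 2 / 3) (F.coeff 0 2 2 / 3)
      (F.coeff 1 2 2 / 3) (F.coeff 0 1 2 / 6) := by
  apply Cubic.ext_coeff
  intro i j k hij hjk
  simp only [cubicSum, Cubic.coeff_add, Cubic.coeff_smul, coeff_cubicMonom]
  fin_cases i <;> fin_cases j <;> fin_cases k <;>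
    first
      | exact absurd hij (by decide)
      | exact absurd hjk (by decide)
      | simp +decide
        try ring

/-- Aronhold's polynomial is symmetric under permutations of the variables. Any labelling of the
variables may therefore be used, and one computation settles transvections in all six positions. -/
theorem aronhold_cubicSum {i j k : Fin 3} (hij : i ≠ j) (hik : i ≠ k) (hjk : j ≠ k)
    (a b c a₂ a₃ b₁ b₃ c₁ c₂ m : ℂ) :
    aronhold (cubicSum i j k a b c a₂ a₃ b₁ b₃ c₁ c₂ m) =
      aronholdPoly a b c a₂ a₃ b₁ b₃ c₁ c₂ m := by
  rw [aronhold_eq_aronholdPoly]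
  simp only [cubicSum, Cubic.coeff_add, Cubic.coeff_smul, coeff_cubicMonom]
  fin_cases i <;> fin_cases j <;> fin_cases k <;>
    first
      | exact absurd rfl hij
      | exact absurd rfl hik
      | exact absurd rfl hjk
      | simp +decide [aronholdPoly]
        try ring

theorem Cubic.exists_eq_cubicSum {i j k : Fin 3} (hij : i ≠ j) (hik : i ≠ k) (hjk : j ≠ k)
    (F : Cubic) :
    ∃ a b c a₂ a₃ b₁ b₃ c₁ c₂ m : ℂ, F = cubicSum i j k a b c a₂ a₃ b₁ b₃ c₁ c₂ m := by
  obtain ⟨a, b, c, a₂, a₃, b₁, b₃, c₁, c₂, m, rfl⟩ : ∃ a b c a₂ a₃ b₁ b₃ c₁ c₂ m : ℂ,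
    F = cubicSum 0 1 2 a b c a₂ a₃ b₁ b₃ c₁ c₂ m := ⟨_, _, _, _, _, _, _, _, _, _, F.eq_cubicSum⟩
  fin_cases i <;> fin_cases j <;> fin_cases k <;>
    first
      | exact absurd rfl hij
      | exact absurd rfl hik
      | exact absurd rfl hjk
      | skip
  · exact ⟨a, b, c, a₂, a₃, b₁, b₃, c₁, c₂, m, rfl⟩
  · refine ⟨a, c, b, a₃, a₂, c₁, c₂, b₁, b₃, m, Subtype.ext ?_⟩
    simp [cubicSum, cubicMonom, MvPolynomial.smul_eq_C_mul]
    ring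
  · refine ⟨b, a, c, b₁, b₃, a₂, a₃, c₂, c₁, m, Subtype.ext ?_⟩
    simp [cubicSum, cubicMonom, MvPolynomial.smul_eq_C_mul]
    ring
  · refine ⟨b, c, a, b₃, b₁, c₂, c₁, a₂, a₃, m, Subtype.ext ?_⟩
    simp [cubicSum, cubicMonom, MvPolynomial.smul_eq_C_mul]
    ring
  · refine ⟨c, a, b, c₁, c₂, a₃, a₂, b₃, b₁, m, Subtype.ext ?_⟩
    simp [cubicSum, cubicMonom, MvPolynomial.smul_eq_C_mul]
    ring
  · refine ⟨c, b, a, c₂, c₁, b₃, b₁, a₃, a₂, m, Subtype.ext ?_⟩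
    simp [cubicSum, cubicMonom, MvPolynomial.smul_eq_C_mul]
    ring

/-- The linear substitution `vₖ ↦ ∑ⱼ hⱼₖ vⱼ` in cubic forms. -/
def cubicSubstitute (h : Matrix (Fin 3) (Fin 3) ℂ) : Cubic →ₗ[ℂ] Cubic :=
  ((MvPolynomial.aeval (linForm h)).toLinearMap).restrict fun F hF => by
    simpa using MvPolynomial.IsHomogeneous.aeval (R := ℂ) (φ := F) (m := 3) hF
      (linForm h) (n := 1) (linForm_isHomogeneous h)

theorem cubicRep_eq_cubicSubstitute (h : GL (Fin 3) ℂ) : cubicRep h = cubicSubstitute h.val := rfl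

theorem coe_cubicSubstitute (h : Matrix (Fin 3) (Fin 3) ℂ) (F : Cubic) :
    (cubicSubstitute h F).1 = MvPolynomial.aeval (linForm h) F.1 := rfl

theorem aeval_linForm_linForm (g h : Matrix (Fin 3) (Fin 3) ℂ) (k : Fin 3) :
    MvPolynomial.aeval (linForm g) (linForm h k) = linForm (g * h) k := by
  simp only [linForm, map_sum, map_mul, MvPolynomial.aeval_X, MvPolynomial.algHom_C,
    MvPolynomial.algebraMap_eq, Matrix.mul_apply, Finset.sum_mul, Finset.mul_sum]
  rw [Finset.sum_comm]
  refine Finset.sum_congr rfl fun i _ => Finset.sum_congr rfl fun j _ => ?_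
  ring

theorem cubicSubstitute_mul (g h : Matrix (Fin 3) (Fin 3) ℂ) (F : Cubic) :
    cubicSubstitute (g * h) F = cubicSubstitute g (cubicSubstitute h F) := by
  apply Subtype.ext
  simp only [coe_cubicSubstitute]
  have key : (MvPolynomial.aeval (linForm (g * h)) :
      MvPolynomial (Fin 3) ℂ →ₐ[ℂ] MvPolynomial (Fin 3) ℂ) =
      (MvPolynomial.aeval (linForm g)).comp (MvPolynomial.aeval (linForm h)) := by
    apply MvPolynomial.algHom_ext
    intro k
    rw [AlgHom.comp_apply, MvPolynomial.aeval_X, MvPolynomial.aeval_X, aeval_linForm_linForm]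
  exact congrArg (fun f => f F.1) key

/-! ### Relative invariance of Aronhold's invariant -/

theorem aronhold_cubicSubstitute_diagonal (D : Fin 3 → ℂ) (F : Cubic) :
    aronhold (cubicSubstitute (diagonal D) F) = (diagonal D).det ^ 4 * aronhold F := by
  obtain ⟨a, b, c, a₂, a₃, b₁, b₃, c₁, c₂, m, rfl⟩ :=
    F.exists_eq_cubicSum (i := 0) (j := 1) (k := 2) (by decide) (by decide) (by decide)
  have hl : ∀ k, linForm (diagonal D) k = MvPolynomial.C (D k) * MvPolynomial.X k := by
    intro k
    simp [linForm, diagonal_apply, apply_ite MvPolynomial.C]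
  have h : cubicSubstitute (diagonal D) (cubicSum 0 1 2 a b c a₂ a₃ b₁ b₃ c₁ c₂ m) =
      cubicSum 0 1 2 (D 0 ^ 3 * a) (D 1 ^ 3 * b) (D 2 ^ 3 * c) (D 0 ^ 2 * D 1 * a₂)
        (D 0 ^ 2 * D 2 * a₃) (D 0 * D 1 ^ 2 * b₁) (D 1 ^ 2 * D 2 * b₃) (D 0 * D 2 ^ 2 * c₁)
        (D 1 * D 2 ^ 2 * c₂) (D 0 * D 1 * D 2 * m) := by
    apply Subtype.ext
    simp [coe_cubicSubstitute, cubicSum, cubicMonom, hl, MvPolynomial.smul_eq_C_mul]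
    ring
  rw [h, aronhold_cubicSum (by decide) (by decide) (by decide),
    aronhold_cubicSum (by decide) (by decide) (by decide), det_diagonal, Fin.prod_univ_three]
  simp only [aronholdPoly]
  ring

theorem aronhold_cubicSubstitute_transvection {i j : Fin 3} (hij : i ≠ j) (s : ℂ)
    (F : Cubic) : aronhold (cubicSubstitute (transvection i j s) F) = aronhold F := by
  obtain ⟨k, hik, hjk⟩ : ∃ k, i ≠ k ∧ j ≠ k := by
    clear s
    revert i j
    decide
  obtain ⟨a, b, c, a₂, a₃, b₁, b₃, c₁, c₂, m, rfl⟩ := F.exists_eq_cubicSum hij hik hjk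
  have hl : ∀ l, linForm (transvection i j s) l =
      MvPolynomial.X l + if j = l then MvPolynomial.C s * MvPolynomial.X i else 0 := by
    intro l
    by_cases h : j = l <;>
    simp [linForm, transvection, Matrix.one_apply,
      Matrix.single_apply, add_mul, Finset.sum_add_distrib, h, apply_ite MvPolynomial.C,
      ite_mul]
  have hi := hl i
  have hj := hl j
  have hk := hl k
  rw [if_neg (Ne.symm hij), add_zero] at hi
  rw [if_pos rfl] at hj
  rw [if_neg hjk, add_zero] at hk
  -- The substitution is $v_j\mapsto v_j+sv_i$ with the other variables fixed; these are the
  -- resulting normalized coefficients.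
  have h : cubicSubstitute (transvection i j s)
      (cubicSum i j k a b c a₂ a₃ b₁ b₃ c₁ c₂ m) =
      cubicSum i j k (a + 3 * s * a₂ + 3 * s ^ 2 * b₁ + s ^ 3 * b) b c (a₂ + 2 * s * b₁ + s ^ 2 * b)
        (a₃ + 2 * s * m + s ^ 2 * b₃) (b₁ + s * b) b₃ (c₁ + s * c₂) c₂ (m + s * b₃) := by
    apply Subtype.ext
    simp [coe_cubicSubstitute, cubicSum, cubicMonom, hi, hj, hk, MvPolynomial.smul_eq_C_mul,
      map_ofNat]
    ring
  rw [h, aronhold_cubicSum hij hik hjk, aronhold_cubicSum hij hik hjk]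
  simp only [aronholdPoly]
  ring

theorem aronhold_cubicSubstitute (h : Matrix (Fin 3) (Fin 3) ℂ) (F : Cubic) :
    aronhold (cubicSubstitute h F) = h.det ^ 4 * aronhold F := by
  refine diagonal_transvection_induction
    (fun h => ∀ F, aronhold (cubicSubstitute h F) = h.det ^ 4 * aronhold F) h
    (fun D _ => aronhold_cubicSubstitute_diagonal D)
    (fun t F => by
      rw [t.det, one_pow, one_mul]
      exact aronhold_cubicSubstitute_transvection t.hij t.c F) ?_ F
  intro A B hA hB F
  rw [cubicSubstitute_mul, hA, hB, det_mul]
  ring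

theorem aronhold_smul (s : ℂ) (F : Cubic) : aronhold (s • F) = s ^ 4 * aronhold F := by
  simp only [aronhold, Cubic.coeff_smul]
  ring

theorem aronhold_weierstrass (α β : ℂ) : aronhold (weierstrass α β) = α := by
  have h : weierstrass α β = cubicSum 0 1 2 1 0 β 0 0 0 (1 / 3) (α / 3) 0 0 := by
    apply Subtype.ext
    simp [weierstrass, cubicSum, cubicMonom, mul_div_cancel₀, MvPolynomial.smul_eq_C_mul]
    ring
  rw [h, aronhold_cubicSum (by decide) (by decide) (by decide), aronholdPoly]
  -- Only the term `a * c₁ * b₃ ^ 2` survives, with value $\alpha/27$.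
  ring

theorem aronhold_comp_mem_coordinateRing {W : Type*} [AddCommGroup W] [Module ℂ W]
    {p : W → Cubic}
    (hp : IsPolynomialFamily fun w => (p w).1) :
    (fun w => aronhold (p w)) ∈ coordinateRing W := by
  have h : ∀ i j k, (fun w => (p w).coeff i j k) ∈ coordinateRing W := fun i j k => hp _
  unfold aronhold
  simp only [div_eq_mul_inv]
  repeat' first
    | exact h _ _ _
    | exact const_mem_coordinateRing _
    | apply pow_mem_coordinateRing
    | apply add_mem_coordinateRing
    | apply sub_mem_coordinateRing
    | apply mul_mem_coordinateRing

theorem aronhold_mem_coordinateRing : aronhold ∈ coordinateRing Cubic :=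
  aronhold_comp_mem_coordinateRing (p := fun F => F) fun m =>
    dual_mem_coordinateRing ((MvPolynomial.lcoeff ℂ m) ∘ₗ Submodule.subtype _)

/-! ### Equivariance of the Plücker map and of the determinant map -/

/-- As functions of the rows of `h`, both sides are alternating trilinear maps on $\mathbb C^3$.
They need only be compared on permutations of the standard basis, where both change by the sign,
hence on the identity matrix. -/
theorem alternatingMap_sum_smul {M N : Type*} [AddCommGroup M] [Module ℂ M] [AddCommGroup N]
    [Module ℂ N] (f : M [⋀^Fin 3]→ₗ[ℂ] N) (h : Matrix (Fin 3) (Fin 3) ℂ) (v : Fin 3 → M) :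
    f (fun k => ∑ l, h k l • v l) = h.det • f v := by
  have key : f.compLinearMap (Fintype.linearCombination ℂ v) =
      (LinearMap.toSpanSingleton ℂ N (f v)).compAlternatingMap Matrix.detRowAlternating := by
    refine Module.Basis.ext_alternating (Pi.basisFun ℂ (Fin 3)) fun i hi => ?_
    obtain ⟨σ, rfl⟩ : ∃ σ : Equiv.Perm (Fin 3), i = σ :=
      ⟨Equiv.ofBijective i (Finite.injective_iff_bijective.mp hi), rfl⟩
    have e1 : (fun k => (Pi.basisFun ℂ (Fin 3)) (σ k)) = (fun k => Pi.single k (1 : ℂ)) ∘ σ := by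
      ext1 k
      simp
    rw [e1, AlternatingMap.map_perm, AlternatingMap.map_perm]
    congr 1
    have e2 : Matrix.detRowAlternating (n := Fin 3) (fun k => Pi.single k (1 : ℂ)) = 1 := by
      change Matrix.det (n := Fin 3) (fun k => Pi.single k (1 : ℂ)) = 1
      rw [← Matrix.det_one (n := Fin 3)]
      congr 1
      ext a b
      simp [Pi.single_apply, Matrix.one_apply, eq_comm]
    rw [LinearMap.compAlternatingMap_apply, e2, LinearMap.toSpanSingleton_apply, one_smul,
      AlternatingMap.compLinearMap_apply]
    congr 1
    ext1 k
    simp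
  exact congrArg (fun F => F h) key

/-- The net `B ∘ φ ∘ A`. -/
def netAct (A B : Matrix (Fin 3) (Fin 3) ℂ) (φ : Noc) : Noc :=
  (Matrix.toLin' B).compQuadraticMap (φ.comp (Matrix.toLin' A))

theorem nocRep_eq_netAct (p : GLGL) (φ : Noc) :
    nocRep p φ = netAct (p.1⁻¹).val p.2.val φ := rfl

theorem netAct_apply (A B : Matrix (Fin 3) (Fin 3) ℂ) (φ : Noc) (x : Fin 3 → ℂ) :
    netAct A B φ x = B *ᵥ φ (A *ᵥ x) := rfl

theorem conic_netAct (A B : Matrix (Fin 3) (Fin 3) ℂ) (φ : Noc) (k : Fin 3) :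
    (netAct A B φ).conic k = ∑ l, B k l • substitute A (φ.conic l) := by
  ext x
  simp only [_root_.sum_apply, _root_.smul_apply]
  rfl

theorem plucker_nocRep (p : GLGL) (φ : Noc) : plucker (nocRep p φ) = pluckerRep p (plucker φ) := by
  have h : (nocRep p φ).conic =
      fun k => ∑ l, p.2.val k l • (substitute (p.1⁻¹).val ∘ φ.conic) l :=
    funext (conic_netAct _ _ φ)
  rw [plucker, h, alternatingMap_sum_smul]
  change _ = p.2.val.det • exteriorPower.map 3 (conicRep p.1) (plucker φ)
  rw [plucker, exteriorPower.map_apply_ιMulti]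
  rfl

theorem J₆_nocRep (p : GLGL) (φ : Noc) :
    J₆ (nocRep p φ) = p.1.val.det⁻¹ ^ 4 * p.2.val.det ^ 2 * J₆ φ := by
  rw [J₆, plucker_nocRep, I₂_pluckerRep, J₆]

theorem polar_conic (q : Conic) (x y : Fin 3 → ℂ) :
    QuadraticMap.polar q x y = 2 * x 0 * y 0 * tcoord 1 q +
      (x 0 * y 1 + x 1 * y 0) * tcoord 2 q + (x 0 * y 2 + x 2 * y 0) * tcoord 3 q +
      2 * x 1 * y 1 * tcoord 4 q + (x 1 * y 2 + x 2 * y 1) * tcoord 5 q +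
      2 * x 2 * y 2 * tcoord 6 q := by
  rw [QuadraticMap.polar, conic_apply q, conic_apply q, conic_apply q]
  simp only [Pi.add_apply]
  ring

theorem gram_eq (q : Conic) : gram q = !![tcoord 1 q, tcoord 2 q / 2, tcoord 3 q / 2;
    tcoord 2 q / 2, tcoord 4 q, tcoord 5 q / 2; tcoord 3 q / 2, tcoord 5 q / 2, tcoord 6 q] := by
  ext i j
  rw [gram, Matrix.of_apply, polar_conic]
  fin_cases i <;> fin_cases j <;> simp

theorem gram_substitute (A : Matrix (Fin 3) (Fin 3) ℂ) (q : Conic) :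
    gram (substitute A q) = Aᵀ * gram q * A := by
  ext i j
  have h : QuadraticMap.polar (substitute A q) (Pi.single i 1) (Pi.single j 1) =
      QuadraticMap.polar q (A *ᵥ Pi.single i 1) (A *ᵥ Pi.single j 1) := by
    rw [QuadraticMap.polar, QuadraticMap.polar, substitute_apply, substitute_apply,
      substitute_apply, Matrix.mulVec_add]
  rw [gram_eq q, gram, Matrix.of_apply, h, polar_conic]
  simp [Matrix.mul_apply, Fin.sum_univ_three]
  ring

theorem gram_sum_smul (h : Fin 3 → ℂ) (q : Fin 3 → Conic) (i j : Fin 3) :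
    gram (∑ l, h l • q l) i j = ∑ l, h l * gram (q l) i j := by
  simp only [gram, Matrix.of_apply, polar_conic, Fin.sum_univ_three, map_add, map_smul,
    smul_eq_mul]
  ring

/-- Each Gram matrix changes by congruence with $g^{-1}$, while mixing the conics by $h$ amounts to
substituting $v_l\mapsto hv_l$ in the entries. Taking determinants gives `delta_nocRep`. -/
theorem netMatrix_nocRep (p : GLGL) (φ : Noc) :
    netMatrix (nocRep p φ) = ((p.1⁻¹).val.map MvPolynomial.C)ᵀ *
      (netMatrix φ).map (MvPolynomial.aeval (linForm p.2.val)) *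
        (p.1⁻¹).val.map MvPolynomial.C := by
  ext1 i j
  have h : netMatrix (nocRep p φ) i j = ∑ l, MvPolynomial.C
      (gram (substitute (p.1⁻¹).val (φ.conic l)) i j) * linForm p.2.val l := by
    simp only [netMatrix, Matrix.of_apply, nocRep_eq_netAct, conic_netAct, gram_sum_smul, linForm, map_sum, map_mul,
      Finset.sum_mul, Finset.mul_sum]
    rw [Finset.sum_comm]
    refine Finset.sum_congr rfl fun i _ => Finset.sum_congr rfl fun j _ => ?_
    ring
  rw [h]
  simp only [gram_substitute, Matrix.mul_apply, Fin.sum_univ_three, Matrix.map_apply,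
    Matrix.transpose_apply, netMatrix, Matrix.of_apply, map_add, map_mul, MvPolynomial.aeval_X,
    MvPolynomial.algHom_C, MvPolynomial.algebraMap_eq]
  ring

theorem delta_nocRep (p : GLGL) (φ : Noc) :
    delta (nocRep p φ) = p.1.val.det⁻¹ ^ 2 • cubicSubstitute p.2.val (delta φ) := by
  apply Subtype.ext
  change (netMatrix (nocRep p φ)).det =
    p.1.val.det⁻¹ ^ 2 • MvPolynomial.aeval (linForm p.2.val) (netMatrix φ).det
  have hC : ((p.1⁻¹).val.map MvPolynomial.C).det =
      (MvPolynomial.C (σ := Fin 3) p.1.val.det⁻¹) := by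
    have := RingHom.map_det (MvPolynomial.C (σ := Fin 3) (R := ℂ)) (p.1⁻¹).val
    rw [RingHom.mapMatrix_apply] at this
    rw [← this, Matrix.coe_units_inv, Matrix.det_nonsing_inv, Ring.inverse_eq_inv']
  have hA := AlgHom.map_det (MvPolynomial.aeval (R := ℂ) (linForm p.2.val)) (netMatrix φ)
  rw [AlgHom.mapMatrix_apply] at hA
  rw [netMatrix_nocRep, det_mul, det_mul, det_transpose, hC, hA, MvPolynomial.smul_eq_C_mul,
    map_pow]
  ring

theorem J₁₂_nocRep (p : GLGL) (φ : Noc) :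
    J₁₂ (nocRep p φ) = p.1.val.det⁻¹ ^ 8 * p.2.val.det ^ 4 * J₁₂ φ := by
  rw [J₁₂, delta_nocRep, aronhold_smul, aronhold_cubicSubstitute, J₁₂]
  ring

/-- The `k`-th conic of a net, as a linear function of the net. -/
def conicLinear (k : Fin 3) : Noc →ₗ[ℂ] Conic where
  toFun φ := φ.conic k
  map_add' _ _ := rfl
  map_smul' _ _ := rfl

theorem J₆_mem_coordinateRing : J₆ ∈ coordinateRing Noc := by
  have hl : ∀ (n : ℕ) (k : Fin 3), (fun φ : Noc => tcoord n (φ.conic k)) ∈ coordinateRing Noc :=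
    fun n k => dual_mem_coordinateRing (tcoord n ∘ₗ conicLinear k)
  have h : ∀ i j k, (fun φ : Noc => tc i j k (plucker φ)) ∈ coordinateRing Noc := by
    intro i j k
    -- On decomposable elements the Plücker coordinates are the $3\times3$ minors of the coefficient
    -- matrix of the net.
    simp only [tc, plucker, exteriorPower.pairingDual_ιMulti_ιMulti, Matrix.det_fin_three,
      Matrix.of_apply, Matrix.cons_val]
    repeat' first
      | exact hl _ _
      | apply add_mem_coordinateRing
      | apply sub_mem_coordinateRing
      | apply mul_mem_coordinateRing
  unfold J₆ I₂
  repeat' first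
    | exact h _ _ _
    | exact const_mem_coordinateRing _
    | apply pow_mem_coordinateRing
    | apply add_mem_coordinateRing
    | apply sub_mem_coordinateRing
    | apply mul_mem_coordinateRing

theorem J₁₂_mem_coordinateRing : J₁₂ ∈ coordinateRing Noc := by
  refine mul_mem_coordinateRing (const_mem_coordinateRing _)
    (aronhold_comp_mem_coordinateRing (p := delta) ?_)
  have h : ∀ i j, IsPolynomialFamily fun φ => netMatrix φ i j := by
    intro i j
    refine IsPolynomialFamily.sum fun k => IsPolynomialFamily.C_mul ?_ _
    simp only [gram, Matrix.of_apply, polar_conic, div_eq_mul_inv]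
    have hl : ∀ n : ℕ, (fun φ : Noc => tcoord n (φ.conic k)) ∈ coordinateRing Noc :=
      fun n => dual_mem_coordinateRing (tcoord n ∘ₗ conicLinear k)
    repeat' first
      | exact hl _
      | exact const_mem_coordinateRing _
      | apply add_mem_coordinateRing
      | apply mul_mem_coordinateRing
  simp only [delta, Matrix.det_fin_three]
  exact (((((((h 0 0).mul (h 1 1)).mul (h 2 2)).sub (((h 0 0).mul (h 1 2)).mul (h 2 1))).sub
    (((h 0 1).mul (h 1 0)).mul (h 2 2))).add (((h 0 1).mul (h 1 2)).mul (h 2 0))).add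
    (((h 0 2).mul (h 1 0)).mul (h 2 1))).sub (((h 0 2).mul (h 1 1)).mul (h 2 0))

/-! ### Values on the normal slice -/

theorem conic_ofConics (M : Fin 3 → Conic) (k : Fin 3) : (Noc.ofConics M).conic k = M k := by
  ext x
  have h : (Noc.ofConics M).conic k x =
      (∑ l, (LinearMap.single ℂ (fun _ : Fin 3 => ℂ) l).compQuadraticMap (M l)) x k := rfl
  rw [h, _root_.sum_apply, Finset.sum_apply]
  simp [Pi.single_apply]

theorem tcoord_monom (i j : Fin 3) :
    tcoord 1 (monom i j) = (if i = 0 ∧ j = 0 then 1 else 0) ∧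
    tcoord 2 (monom i j) = (if (i = 0 ∧ j = 1) ∨ (i = 1 ∧ j = 0) then 1 else 0) ∧
    tcoord 3 (monom i j) = (if (i = 0 ∧ j = 2) ∨ (i = 2 ∧ j = 0) then 1 else 0) ∧
    tcoord 4 (monom i j) = (if i = 1 ∧ j = 1 then 1 else 0) ∧
    tcoord 5 (monom i j) = (if (i = 1 ∧ j = 2) ∨ (i = 2 ∧ j = 1) then 1 else 0) ∧
    tcoord 6 (monom i j) = (if i = 2 ∧ j = 2 then 1 else 0) := by
  fin_cases i <;> fin_cases j <;>
    simp +decide [tcoord, coeffSq, coeffMixed, monom, QuadraticMap.polar]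

/-- The coordinates of the conics of `ν_{c,g}`. -/
theorem tcoord_nu (c g : ℂ) (k : Fin 3) :
    tcoord 1 ((nu c g).conic k) = ![0, 0, -1] k ∧ tcoord 2 ((nu c g).conic k) = 0 ∧
    tcoord 3 ((nu c g).conic k) = ![2, 0, 2 * g] k ∧
    tcoord 4 ((nu c g).conic k) = ![1, 0, -(2 * g)] k ∧
    tcoord 5 ((nu c g).conic k) = ![0, 2, 0] k ∧ tcoord 6 ((nu c g).conic k) = ![0, 0, c] k := by
  rw [nu, conic_ofConics]
  fin_cases k <;>
    simp [tcoord_monom]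

theorem J₆_nu (c g : ℂ) : J₆ (nu c g) = 24 * g := by
  have h := tcoord_nu c g
  simp only [J₆, I₂, tc, plucker, exteriorPower.pairingDual_ιMulti_ιMulti, Matrix.det_fin_three,
      Matrix.of_apply, Matrix.cons_val, h]
  ring

theorem J₁₂_nu (c g : ℂ) : J₁₂ (nu c g) = -48 * (c - 3 * g ^ 2) := by
  -- The discriminant cubic is $-v_1^3+v_2^2v_3+(3g^2-c)v_1v_3^2+(2gc+2g^3)v_3^3$, a Weierstrass
  -- form up to the sign of $v_1^3$.
  have h : delta (nu c g) = cubicSum 0 1 2 (-1) 0 (2 * g * c + 2 * g ^ 3) 0 0 0 (1 / 3)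
      ((3 * g ^ 2 - c) / 3) 0 0 := by
    apply Subtype.ext
    simp [delta, Matrix.det_fin_three, netMatrix, gram_eq, tcoord_nu, Fin.sum_univ_three, cubicSum,
      cubicMonom, mul_div_cancel₀, MvPolynomial.smul_eq_C_mul, map_ofNat]
    ring
  rw [J₁₂, h, aronhold_cubicSum (by decide) (by decide) (by decide), aronholdPoly]
  ring

/-! ### The translates of the normal slice are dense -/

theorem nu_apply (c g : ℂ) (x : Fin 3 → ℂ) :
    nu c g x = ![x 1 ^ 2 + 2 * (x 0 * x 2), 2 * (x 1 * x 2),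
      -x 0 ^ 2 + 2 * g * (x 0 * x 2 - x 1 ^ 2) + c * x 2 ^ 2] := by
  have h : ∀ k, nu c g x k = (nu c g).conic k x := fun _ => rfl
  ext k
  rw [h, nu, conic_ofConics]
  fin_cases k <;> simp [monom] <;> ring

/-- Scalars act on the slice modulo $\mathrm{SL}\times\mathrm{SL}$: both diagonal matrices have
determinant 1. The weights 12 and 6 of $c$ and $g$ match the degrees of `J₁₂` and `J₆`. -/
theorem smul_nu {s : ℂ} (hs : s ≠ 0) (c g : ℂ) :
    s • nu c g = netAct (diagonal ![s ^ 3, 1, (s ^ 3)⁻¹]) (diagonal ![s, s ^ 4, (s ^ 5)⁻¹])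
      (nu (s ^ 12 * c) (s ^ 6 * g)) := by
  ext x k
  rw [netAct_apply, mulVec_diagonal, nu_apply, _root_.smul_apply, nu_apply]
  fin_cases k
  · simp [mulVec_diagonal]
    field_simp
    simp
  · simp [mulVec_diagonal]
    field_simp
  · simp [mulVec_diagonal]
    field_simp

section

variable {f : Noc → ℂ} (hf : f ∈ invariantRing (nocRep.comp slToGL))

include hf in
theorem invariant_netAct {A B : Matrix (Fin 3) (Fin 3) ℂ} (hA : A.det = 1) (hB : B.det = 1)
    (φ : Noc) : f (netAct A B φ) = f φ := by
  let S : SL(3, ℂ) := ⟨A, hA⟩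
  let T : SL(3, ℂ) := ⟨B, hB⟩
  -- The group acts on the source through $g^{-1}$, so precomposition with `A` is the action of its
  -- inverse.
  have h := hf.2 (S⁻¹, T) φ
  have e : (Matrix.SpecialLinearGroup.toGL S⁻¹)⁻¹ = Matrix.SpecialLinearGroup.toGL S := by
    rw [map_inv, inv_inv]
  have e' : (slToGL (S⁻¹, T)).1⁻¹ = Matrix.SpecialLinearGroup.toGL S := e
  rw [MonoidHom.comp_apply, nocRep_eq_netAct, e'] at h
  exact h

-- Dividing `A` and `B` by cube roots `s`, `r` of their determinants makes both unimodular. Nets are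
-- quadratic in the source, so this costs the scalar `r * s ^ 2`, which `smul_nu` absorbs into the
-- parameters of the slice.
include hf in
theorem invariant_netAct_nu (h0 : ∀ c g, f (nu c g) = 0) {A B : Matrix (Fin 3) (Fin 3) ℂ}
    (hA : A.det ≠ 0) (hB : B.det ≠ 0) (c g : ℂ) : f (netAct A B (nu c g)) = 0 := by
  obtain ⟨s, hs⟩ := IsAlgClosed.exists_pow_nat_eq A.det (n := 3) (by norm_num)
  obtain ⟨r, hr⟩ := IsAlgClosed.exists_pow_nat_eq B.det (n := 3) (by norm_num)
  have hs0 : s ≠ 0 := by rintro rfl; simp [← hs] at hA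
  have hr0 : r ≠ 0 := by rintro rfl; simp [← hr] at hB
  have h : netAct A B (nu c g) = netAct (s⁻¹ • A) (r⁻¹ • B) ((r * s ^ 2) • nu c g) := by
    ext x k
    simp only [netAct_apply, smul_mulVec, _root_.smul_apply, QuadraticMap.map_smul, mulVec_smul,
      smul_smul]
    simp only [Pi.smul_apply, smul_eq_mul]
    field_simp
  have hl : r * s ^ 2 ≠ 0 := mul_ne_zero hr0 (pow_ne_zero 2 hs0)
  rw [h, invariant_netAct hf, smul_nu hl, invariant_netAct hf, h0]
  · simp [det_diagonal, Fin.prod_univ_three]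
    field_simp
  · simp [det_diagonal, Fin.prod_univ_three]
    field_simp
  · rw [det_smul, ← hs]
    simp
    field_simp
  · rw [det_smul, ← hr]
    simp
    field_simp

end

/-! ### Local surjectivity of the translation map near $\nu_{0,0}$ -/

theorem Noc.apply_eq_conic (φ : Noc) (x : Fin 3 → ℂ) (k : Fin 3) : φ x k = φ.conic k x := rfl

theorem Noc.conic_add (φ ψ : Noc) (k : Fin 3) : (φ + ψ).conic k = φ.conic k + ψ.conic k := rfl

theorem Noc.conic_smul (s : ℂ) (φ : Noc) (k : Fin 3) : (s • φ).conic k = s • φ.conic k := rfl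

/-- Coordinates on the space of nets: `a k n` is the coefficient of `e_{n+1}` in the `k`-th
conic. -/
abbrev NetCoord : Type := Fin 3 → Fin 6 → ℂ

/-- The net with given coordinates. -/
def netOfCoord : NetCoord →ₗ[ℂ] Noc where
  toFun a := Noc.ofConics fun k => a k 0 • monom 0 0 + a k 1 • monom 0 1 + a k 2 • monom 0 2 +
    a k 3 • monom 1 1 + a k 4 • monom 1 2 + a k 5 • monom 2 2
  map_add' a b := by
    ext x k
    simp only [Noc.apply_eq_conic, Noc.conic_add, conic_ofConics]
    simp
    ring
  map_smul' s a := by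
    ext x k
    simp only [Noc.apply_eq_conic, Noc.conic_smul, conic_ofConics]
    simp
    ring

/-- The coordinates of a net. -/
def coordOfNet (φ : Noc) : NetCoord := fun k n => tcoord (n + 1) (φ.conic k)

theorem netOfCoord_coordOfNet (φ : Noc) : netOfCoord (coordOfNet φ) = φ := by
  ext x k
  rw [netOfCoord, LinearMap.coe_mk, AddHom.coe_mk, Noc.apply_eq_conic, Noc.apply_eq_conic φ,
    conic_ofConics, conic_apply (φ.conic k)]
  simp [coordOfNet, monom]
  ring

/-- The coordinate `a ↦ a k n`. -/
def coordProj (k : Fin 3) (n : Fin 6) : NetCoord →L[ℂ] ℂ :=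
  (ContinuousLinearMap.proj n : (Fin 6 → ℂ) →L[ℂ] ℂ).comp
    (ContinuousLinearMap.proj k : NetCoord →L[ℂ] Fin 6 → ℂ)

@[simp]
theorem coordProj_apply (k : Fin 3) (n : Fin 6) (a : NetCoord) : coordProj k n a = a k n := rfl

/-- The source component of a right inverse of the differential of the action at `ν_{0,0}`. -/
def sourceDirection : Matrix (Fin 3) (Fin 3) (NetCoord →L[ℂ] ℂ) :=
  let p := coordProj
  !![-(1 / 2 : ℂ) • p 2 0, -(1 / 2 : ℂ) • p 2 1, (1 / 2 : ℂ) • p 0 5;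
    (1 / 3 : ℂ) • p 0 1 + (1 / 6 : ℂ) • p 1 2 - (1 / 3 : ℂ) • p 1 3,
      -(1 / 4 : ℂ) • p 0 2 + (1 / 2 : ℂ) • p 0 3 - (1 / 4 : ℂ) • p 2 0, (1 / 2 : ℂ) • p 1 5;
    (1 / 2 : ℂ) • p 1 1, (1 / 6 : ℂ) • p 0 1 - (1 / 6 : ℂ) • p 1 2 + (1 / 3 : ℂ) • p 1 3, 0]

/-- The target component of a right inverse of the differential of the action at `ν_{0,0}`. -/
def targetDirection : Matrix (Fin 3) (Fin 3) (NetCoord →L[ℂ] ℂ) :=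
  let p := coordProj
  !![(1 / 2 : ℂ) • p 0 2 + (1 / 2 : ℂ) • p 2 0,
      (1 / 2 : ℂ) • p 0 4 - (1 / 2 : ℂ) • p 1 5 + (1 / 2 : ℂ) • p 2 1, p 1 1 - p 0 0;
    -(1 / 3 : ℂ) • p 0 1 + (1 / 3 : ℂ) • p 1 2 + (1 / 3 : ℂ) • p 1 3,
      (1 / 4 : ℂ) • p 0 2 - (1 / 2 : ℂ) • p 0 3 + (1 / 2 : ℂ) • p 1 4 + (1 / 4 : ℂ) • p 2 0,
      -p 1 0;
    (1 / 3 : ℂ) • p 0 5 + (1 / 3 : ℂ) • p 2 2 + (1 / 3 : ℂ) • p 2 3, (1 / 2 : ℂ) • p 2 4, 0]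

/-- The slice component of a right inverse of the differential of the action at `ν_{0,0}`. -/
def sliceDirection : NetCoord →L[ℂ] ℂ :=
  (1 / 6 : ℂ) • coordProj 0 5 + (1 / 6 : ℂ) • coordProj 2 2 - (1 / 3 : ℂ) • coordProj 2 3

theorem sourceDirection_apply (i j : Fin 3) (a : NetCoord) : sourceDirection i j a =
    !![-(1 / 2) * a 2 0, -(1 / 2) * a 2 1, (1 / 2) * a 0 5;
      (1 / 3) * a 0 1 + (1 / 6) * a 1 2 - (1 / 3) * a 1 3,
        -(1 / 4) * a 0 2 + (1 / 2) * a 0 3 - (1 / 4) * a 2 0, (1 / 2) * a 1 5;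
      (1 / 2) * a 1 1, (1 / 6) * a 0 1 - (1 / 6) * a 1 2 + (1 / 3) * a 1 3, 0] i j := by
  fin_cases i <;> fin_cases j <;> simp [sourceDirection]

theorem targetDirection_apply (i j : Fin 3) (a : NetCoord) : targetDirection i j a =
    !![(1 / 2) * a 0 2 + (1 / 2) * a 2 0,
        (1 / 2) * a 0 4 - (1 / 2) * a 1 5 + (1 / 2) * a 2 1, a 1 1 - a 0 0;
      -(1 / 3) * a 0 1 + (1 / 3) * a 1 2 + (1 / 3) * a 1 3,
        (1 / 4) * a 0 2 - (1 / 2) * a 0 3 + (1 / 2) * a 1 4 + (1 / 4) * a 2 0, -a 1 0;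
      (1 / 3) * a 0 5 + (1 / 3) * a 2 2 + (1 / 3) * a 2 3, (1 / 2) * a 2 4, 0] i j := by
  fin_cases i <;> fin_cases j <;> simp [targetDirection]

/-- The substitution in the source attached to `a`. -/
def sourceMatrix (a : NetCoord) : Matrix (Fin 3) (Fin 3) ℂ :=
  of fun i j => (1 : Matrix (Fin 3) (Fin 3) ℂ) i j + sourceDirection i j a

/-- The substitution in the target attached to `a`. -/
def targetMatrix (a : NetCoord) : Matrix (Fin 3) (Fin 3) ℂ :=
  of fun i j => (1 : Matrix (Fin 3) (Fin 3) ℂ) i j + targetDirection i j a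

/-- A family of translates of points of the normal slice. -/
def sliceTranslate (a : NetCoord) : Noc :=
  netAct (sourceMatrix a) (targetMatrix a) (nu (a 2 5) (sliceDirection a))

theorem tcoord_netAct_nu (A B : Matrix (Fin 3) (Fin 3) ℂ) (c g : ℂ) (n : ℕ) (k : Fin 3) :
    tcoord n ((netAct A B (nu c g)).conic k) =
      B k 0 * tcoord n (substitute A ((nu c g).conic 0)) +
      B k 1 * tcoord n (substitute A ((nu c g).conic 1)) +
      B k 2 * tcoord n (substitute A ((nu c g).conic 2)) := by
  rw [conic_netAct, Fin.sum_univ_three]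
  simp

theorem coeffSq_substitute_nu (A : Matrix (Fin 3) (Fin 3) ℂ) (c g : ℂ) (i : Fin 3) :
    coeffSq i (substitute A ((nu c g).conic 0)) = A 1 i * A 1 i + 2 * (A 0 i * A 2 i) ∧
    coeffSq i (substitute A ((nu c g).conic 1)) = 2 * (A 1 i * A 2 i) ∧
    coeffSq i (substitute A ((nu c g).conic 2)) =
      -(A 0 i * A 0 i) + 2 * (g * (A 0 i * A 2 i - A 1 i * A 1 i)) + c * (A 2 i * A 2 i) := by
  have h := fun q => congrArg (fun l => l q) (coeffSq_substitute A i)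
  simp only [LinearMap.comp_apply] at h
  simp only [h]
  simp [tcoord_nu]
  refine ⟨?_, ?_, ?_⟩ <;> ring

theorem coeffMixed_substitute_nu (A : Matrix (Fin 3) (Fin 3) ℂ) (c g : ℂ) (i j : Fin 3) :
    coeffMixed i j (substitute A ((nu c g).conic 0)) =
      2 * (A 1 i * A 1 j) + 2 * (A 0 i * A 2 j + A 2 i * A 0 j) ∧
    coeffMixed i j (substitute A ((nu c g).conic 1)) = 2 * (A 1 i * A 2 j + A 2 i * A 1 j) ∧
    coeffMixed i j (substitute A ((nu c g).conic 2)) =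
      2 * (-(A 0 i * A 0 j) + g * (A 0 i * A 2 j + A 2 i * A 0 j - 2 * (A 1 i * A 1 j)) +
        c * (A 2 i * A 2 j)) := by
  have h := fun q => congrArg (fun l => l q) (coeffMixed_substitute A i j)
  simp only [LinearMap.comp_apply] at h
  simp only [h]
  simp [tcoord_nu]
  refine ⟨?_, ?_, ?_⟩ <;> ring

-- The linear forms in `sourceDirection`, `targetDirection` and `sliceDirection`, together with
-- $c=a_{2,5}$, solve the linearized equation at $\nu_{0,0}$ for an arbitrary right-hand side $a$.
-- The derivative of the resulting family is therefore the identity.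
set_option maxHeartbeats 1000000 in
theorem hasStrictFDerivAt_coordOfNet_sliceTranslate :
    HasStrictFDerivAt (fun a => coordOfNet (sliceTranslate a))
      (ContinuousLinearMap.id ℂ NetCoord) 0 := by
  have hA : ∀ i j, HasStrictFDerivAt (fun a => sourceMatrix a i j) (sourceDirection i j) 0 :=
    fun i j => (sourceDirection i j).hasStrictFDerivAt.const_add _
  have hB : ∀ i j, HasStrictFDerivAt (fun a => targetMatrix a i j) (targetDirection i j) 0 :=
    fun i j => (targetDirection i j).hasStrictFDerivAt.const_add _
  have hc : HasStrictFDerivAt (fun a : NetCoord => a 2 5) (coordProj 2 5) 0 :=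
    (coordProj 2 5).hasStrictFDerivAt
  have hg : HasStrictFDerivAt (fun a : NetCoord => sliceDirection a) sliceDirection 0 :=
    sliceDirection.hasStrictFDerivAt
  have hA0 : ∀ i j, sourceMatrix 0 i j = (1 : Matrix (Fin 3) (Fin 3) ℂ) i j := by
    simp [sourceMatrix]
  have hB0 : ∀ i j, targetMatrix 0 i j = (1 : Matrix (Fin 3) (Fin 3) ℂ) i j := by
    simp [targetMatrix]
  rw [hasStrictFDerivAt_pi']
  intro k
  rw [hasStrictFDerivAt_pi']
  intro n
  simp only [coordOfNet, sliceTranslate, tcoord_netAct_nu]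
  fin_cases n <;>
    simp only [tcoord, coeffSq_substitute_nu, coeffMixed_substitute_nu]
  all_goals
    apply HasStrictFDerivAt.congr_fderiv
    case h => repeat' first
        | exact hA _ _
        | exact hB _ _
        | exact hc
        | exact hg
        | exact hasStrictFDerivAt_const _ _
        | apply HasStrictFDerivAt.fun_add
        | apply HasStrictFDerivAt.fun_sub
        | apply HasStrictFDerivAt.fun_neg
        | apply HasStrictFDerivAt.fun_mul
    case h' =>
      ext a
      simp only [_root_.add_apply, _root_.sub_apply, _root_.neg_apply,
        _root_.smul_apply, _root_.zero_apply, smul_eq_mul, hA0, hB0,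
        map_zero, Pi.zero_apply, Matrix.one_apply_eq, Matrix.one_apply_ne, ne_eq, Fin.reduceEq,
        not_false_eq_true, mul_zero, zero_mul, add_zero, zero_add, mul_one, one_mul, sub_zero,
        neg_zero, ContinuousLinearMap.comp_apply, ContinuousLinearMap.proj_apply,
        ContinuousLinearMap.id_apply, sourceDirection_apply, targetDirection_apply]
      fin_cases k <;>
      simp [sliceDirection, Matrix.one_apply] <;> ring

theorem eq_zero_of_eq_zero_on_slice {f : Noc → ℂ}
    (hf : f ∈ invariantRing (nocRep.comp slToGL)) (h0 : ∀ c g, f (nu c g) = 0) : f = 0 := by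
  refine eq_zero_of_eventually_eq_zero netOfCoord
    (fun φ => ⟨_, netOfCoord_coordOfNet φ⟩) hf.1 (coordOfNet (sliceTranslate 0)) ?_
  -- A surjective strict derivative makes the family open at 0, so vanishing near the image point
  -- may be tested on parameters near 0. There both matrices are still invertible.
  have hmap := hasStrictFDerivAt_coordOfNet_sliceTranslate.map_nhds_eq_of_surj (by simp)
  rw [← hmap, Filter.eventually_map]
  have hA : Continuous fun a => (sourceMatrix a).det :=
    Continuous.matrix_det (continuous_matrix fun i j => by
      simp only [sourceMatrix, Matrix.of_apply]; fun_prop)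
  have hB : Continuous fun a => (targetMatrix a).det :=
    Continuous.matrix_det (continuous_matrix fun i j => by
      simp only [targetMatrix, Matrix.of_apply]; fun_prop)
  have hA0 : (sourceMatrix 0).det ≠ 0 := by
    have : sourceMatrix 0 = 1 := by ext; simp [sourceMatrix]
    simp [this]
  have hB0 : (targetMatrix 0).det ≠ 0 := by
    have : targetMatrix 0 = 1 := by ext; simp [targetMatrix]
    simp [this]
  filter_upwards [hA.continuousAt.eventually_ne hA0, hB.continuousAt.eventually_ne hB0] with a ha hb
  rw [netOfCoord_coordOfNet]
  exact invariant_netAct_nu hf h0 ha hb _ _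

/-! ### The ring of invariants and the semi-invariants -/

theorem invariant_of_relative {f : Noc → ℂ} {χ : GLGL →* ℂˣ}
    (hf : f ∈ relativeInvariants nocRep χ) : f ∈ invariantRing (nocRep.comp slToGL) := by
  refine ⟨hf.1, fun p φ => ?_⟩
  rw [MonoidHom.comp_apply, hf.2, hom_slToGL, Units.val_one, one_mul]

theorem detCharacter_apply (a b : ℤ) (p : GLGL) :
    (detCharacter a b p : ℂ) = p.1.val.det ^ a * p.2.val.det ^ b := by
  simp [detCharacter]

theorem detCharacter_mul (a b a' b' : ℤ) :
    detCharacter a b * detCharacter a' b' = detCharacter (a + a') (b + b') := by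
  ext p
  have hg : p.1.val.det ≠ 0 := ((Matrix.isUnit_iff_isUnit_det _).mp p.1.isUnit).ne_zero
  have hh : p.2.val.det ≠ 0 := ((Matrix.isUnit_iff_isUnit_det _).mp p.2.isUnit).ne_zero
  rw [MonoidHom.mul_apply, Units.val_mul, detCharacter_apply, detCharacter_apply,
    detCharacter_apply, zpow_add₀ hg, zpow_add₀ hh]
  ring

theorem isRegularCharacter_detCharacter (a b : ℤ) : IsRegularCharacter (detCharacter a b) := by
  let X : Matrix (Fin 3) (Fin 3) (MvPolynomial ((Fin 3 × Fin 3) ⊕ (Fin 3 × Fin 3)) ℂ) :=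
    Matrix.of fun i j => MvPolynomial.X (Sum.inl (i, j))
  let Y : Matrix (Fin 3) (Fin 3) (MvPolynomial ((Fin 3 × Fin 3) ⊕ (Fin 3 × Fin 3)) ℂ) :=
    Matrix.of fun i j => MvPolynomial.X (Sum.inr (i, j))
  -- Any `n` at least $|a|$ and $|b|$ clears the negative powers of the determinants.
  obtain ⟨n, ha, hb⟩ : ∃ n : ℕ, 0 ≤ a + n ∧ 0 ≤ b + n :=
    ⟨a.natAbs + b.natAbs, by omega, by omega⟩
  refine ⟨X.det ^ (a + n).toNat * Y.det ^ (b + n).toNat, n, fun g h => ?_⟩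
  set v := Sum.elim (fun p : Fin 3 × Fin 3 => g.val p.1 p.2) (fun p : Fin 3 × Fin 3 => h.val p.1 p.2)
    with hv
  have hX : MvPolynomial.eval v X.det = g.val.det := by
    rw [RingHom.map_det]
    congr 1
    ext i j
    simp [X, v]
  have hY : MvPolynomial.eval v Y.det = h.val.det := by
    rw [RingHom.map_det]
    congr 1
    ext i j
    simp [Y, v]
  have hpow : ∀ (z : ℂ) (m : ℤ), z ≠ 0 → 0 ≤ m + n → z ^ (m + n).toNat = z ^ m * z ^ n := by
    intro z m hz hm
    rw [← zpow_natCast, Int.toNat_of_nonneg hm, zpow_add₀ hz, zpow_natCast]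
  have hg : g.val.det ≠ 0 := ((Matrix.isUnit_iff_isUnit_det _).mp g.isUnit).ne_zero
  have hh : h.val.det ≠ 0 := ((Matrix.isUnit_iff_isUnit_det _).mp h.isUnit).ne_zero
  rw [map_mul, map_pow, map_pow, hX, hY, hpow _ _ hg ha, hpow _ _ hh hb, detCharacter_apply]
  ring

theorem J₆_mem_relativeInvariants : J₆ ∈ relativeInvariants nocRep (detCharacter (-4) 2) := by
  refine ⟨J₆_mem_coordinateRing, fun p φ => ?_⟩
  rw [J₆_nocRep, detCharacter_apply, _root_.zpow_neg, inv_pow]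
  norm_cast

theorem J₁₂_mem_relativeInvariants : J₁₂ ∈ relativeInvariants nocRep (detCharacter (-8) 4) := by
  refine ⟨J₁₂_mem_coordinateRing, fun p φ => ?_⟩
  rw [J₁₂_nocRep, detCharacter_apply, _root_.zpow_neg, inv_pow]
  norm_cast

theorem eval_aeval_pair (P : MvPolynomial (Fin 2) ℂ) (f g : Noc → ℂ) (φ : Noc) :
    MvPolynomial.aeval ![f, g] P φ = MvPolynomial.eval ![f φ, g φ] P := by
  have h : (Pi.evalAlgHom ℂ (fun _ : Noc => ℂ) φ).comp (MvPolynomial.aeval ![f, g]) =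
      MvPolynomial.aeval ![f φ, g φ] := by
    apply MvPolynomial.algHom_ext
    intro i
    fin_cases i <;> simp
  exact congrArg (fun F => F P) h

theorem algebraicIndependent_J₆_J₁₂ : AlgebraicIndependent ℂ ![J₆, J₁₂] := by
  rw [algebraicIndependent_iff]
  intro P hP
  apply MvPolynomial.funext
  intro x
  -- The parameters solve $24g=x_0$ and $-48(c-3g^2)=x_1$: the pair of invariants already takes
  -- every value on the slice, so a relation vanishes at every point of $\mathbb C^2$.
  have h := congrFun hP (nu (3 * (x 0 / 24) ^ 2 - x 1 / 48) (x 0 / 24))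
  rw [eval_aeval_pair, J₆_nu, J₁₂_nu] at h
  rw [map_zero]
  refine Eq.trans ?_ h
  congr 1
  congr 1
  ext i
  fin_cases i
  · simp
    ring
  · simp
    ring

theorem nu_eq_plane (c g : ℂ) : nu c g = nu 0 0 + c • (nu 1 0 - nu 0 0) + g • (nu 0 1 - nu 0 0) := by
  ext x k
  simp only [_root_.add_apply, _root_.smul_apply, _root_.sub_apply, nu_apply]
  fin_cases k <;> simp
  ring

theorem aeval_pair_mem {S : Subalgebra ℂ (Noc → ℂ)} {f g : Noc → ℂ} (hf : f ∈ S) (hg : g ∈ S)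
    (P : MvPolynomial (Fin 2) ℂ) : MvPolynomial.aeval ![f, g] P ∈ S := by
  induction P using MvPolynomial.induction_on with
  | C a => simp
  | add p q hp hq => simpa using add_mem hp hq
  | mul_X p i hp =>
    rw [map_mul, MvPolynomial.aeval_X]
    refine mul_mem hp ?_
    fin_cases i
    · exact hf
    · exact hg

theorem adjoin_eq_invariantRing :
    Algebra.adjoin ℂ {J₆, J₁₂} = invariantRing (nocRep.comp slToGL) := by
  have hle : Algebra.adjoin ℂ {J₆, J₁₂} ≤ invariantRing (nocRep.comp slToGL) := by
    refine Algebra.adjoin_le ?_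
    rintro f (rfl | rfl)
    · exact invariant_of_relative J₆_mem_relativeInvariants
    · exact invariant_of_relative J₁₂_mem_relativeInvariants
  refine le_antisymm hle fun f hf => ?_
  obtain ⟨P, hP⟩ := exists_mvPolynomial_plane hf.1 (nu 0 0) (nu 1 0 - nu 0 0) (nu 0 1 - nu 0 0)
  have h6 : J₆ ∈ Algebra.adjoin ℂ {J₆, J₁₂} := Algebra.subset_adjoin (by simp)
  have h12 : J₁₂ ∈ Algebra.adjoin ℂ {J₆, J₁₂} := Algebra.subset_adjoin (by simp)
  -- `G` and `C` are the polynomials in `J₆` and `J₁₂` that restrict to the coordinates $g$ and $c$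
  -- of the slice. Hence `f` and `P` evaluated at `C`, `G` are invariants that agree on the slice.
  set G : Noc → ℂ := (1 / 24 : ℂ) • J₆ with hG
  set C : Noc → ℂ := (3 : ℂ) • G ^ 2 - (1 / 48 : ℂ) • J₁₂ with hC
  have hGm : G ∈ Algebra.adjoin ℂ {J₆, J₁₂} := Subalgebra.smul_mem _ h6 _
  have hCm : C ∈ Algebra.adjoin ℂ {J₆, J₁₂} :=
    sub_mem (Subalgebra.smul_mem _ (pow_mem hGm 2) _) (Subalgebra.smul_mem _ h12 _)
  have hm := aeval_pair_mem hCm hGm P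
  have h0 : f - MvPolynomial.aeval ![C, G] P = 0 := by
    refine eq_zero_of_eq_zero_on_slice (sub_mem hf (hle hm)) fun c g => ?_
    have e1 : G (nu c g) = g := by
      simp [hG, J₆_nu]
    have e2 : C (nu c g) = c := by
      simp [hC, e1, J₁₂_nu]
    rw [Pi.sub_apply, eval_aeval_pair, e1, e2, ← hP ![c, g], sub_eq_zero, nu_eq_plane c g]
    simp
  rw [sub_eq_zero.mp h0]
  exact hm

theorem semiInvariants_eq_invariantRing :
    semiInvariants nocRep = Subalgebra.toSubmodule (invariantRing (nocRep.comp slToGL)) := by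
  refine le_antisymm (iSup_le fun χ f hf => invariant_of_relative hf) ?_
  -- For the reverse inclusion, the ring is spanned by monomials in `J₆` and `J₁₂`, and each is a
  -- relative invariant for a product of determinant characters.
  rw [← adjoin_eq_invariantRing, Algebra.adjoin_eq_span, Submodule.span_le]
  intro f hf
  obtain ⟨a, b, h⟩ : ∃ a b : ℤ, f ∈ relativeInvariants nocRep (detCharacter a b) := by
    induction hf using Submonoid.closure_induction with
    | mem f hf =>
      rcases hf with rfl | rfl
      · exact ⟨_, _, J₆_mem_relativeInvariants⟩
      · exact ⟨_, _, J₁₂_mem_relativeInvariants⟩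
    | one =>
      exact ⟨0, 0, one_mem _, fun p φ => by simp [detCharacter_apply]⟩
    | mul f f' _ _ hf hf' =>
      obtain ⟨a, b, h⟩ := hf
      obtain ⟨a', b', h'⟩ := hf'
      refine ⟨a + a', b + b', mul_mem h.1 h'.1, fun p φ => ?_⟩
      rw [Pi.mul_apply, Pi.mul_apply, h.2, h'.2, ← detCharacter_mul, MonoidHom.mul_apply,
        Units.val_mul]
      ring
  exact Submodule.mem_iSup_of_mem
    (⟨detCharacter a b, isRegularCharacter_detCharacter a b⟩ :
      {χ : GLGL →* ℂˣ // IsRegularCharacter χ}) h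

theorem I₂_mem_invariantRing : I₂ ∈ invariantRing (pluckerRep.comp slToGL) := by
  refine ⟨I₂_mem_coordinateRing, fun p w => ?_⟩
  rw [MonoidHom.comp_apply, I₂_pluckerRep]
  simp [slToGL]

theorem aronhold_mem_invariantRing :
    aronhold ∈ invariantRing (cubicRep.comp Matrix.SpecialLinearGroup.toGL) := by
  refine ⟨aronhold_mem_coordinateRing, fun h F => ?_⟩
  rw [MonoidHom.comp_apply, cubicRep_eq_cubicSubstitute, aronhold_cubicSubstitute]
  simp

end NetsOfConics

end

open NetsOfConics in
theorem theorem5p4 :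
    -- the ring of `SL₃ × SL₃`-invariants is freely generated by `J₆` and `J₁₂`
    AlgebraicIndependent ℂ ![J₆, J₁₂] ∧
    Algebra.adjoin ℂ {J₆, J₁₂} = invariantRing (nocRep.comp slToGL) ∧
    -- it is the ring of semi-invariants of `GL₃ × GL₃`
    semiInvariants nocRep = Subalgebra.toSubmodule (invariantRing (nocRep.comp slToGL)) ∧
    J₆ ∈ relativeInvariants nocRep (detCharacter (-4) 2) ∧
    J₁₂ ∈ relativeInvariants nocRep (detCharacter (-8) 4) ∧
    -- `I₂` is an invariant of degree 2 of the Plücker space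
    I₂ ∈ invariantRing (pluckerRep.comp slToGL) ∧
    (∀ (s : ℂ) (w : PluckerSpace), I₂ (s • w) = s ^ 2 * I₂ w) ∧
    -- `aronhold` is the invariant of degree 4 of plane cubics, normalized on Weierstrass forms
    aronhold ∈ invariantRing (cubicRep.comp Matrix.SpecialLinearGroup.toGL) ∧
    (∀ (s : ℂ) (F : Cubic), aronhold (s • F) = s ^ 4 * aronhold F) ∧
    (∀ α β : ℂ, aronhold (weierstrass α β) = α) ∧
    -- restrictions to the normal slice
    (∀ c g : ℂ, J₆ (nu c g) = 24 * g ∧ J₁₂ (nu c g) = -48 * (c - 3 * g ^ 2)) :=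
  ⟨algebraicIndependent_J₆_J₁₂, adjoin_eq_invariantRing, semiInvariants_eq_invariantRing,
    J₆_mem_relativeInvariants, J₁₂_mem_relativeInvariants, I₂_mem_invariantRing, I₂_smul,
    aronhold_mem_invariantRing, aronhold_smul, aronhold_weierstrass,
    fun c g => ⟨J₆_nu c g, J₁₂_nu c g⟩⟩
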